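/- Let $\beta_0>0$ and $r>0$. For complex $\kappa$ with $\mathrm{Re}\,\kappa>0$ and integers $m\ge 0$ put $$S_m(\kappa)=\sum_{n\ge1}\frac{n^m(-1)^n}{e^{n\kappa\beta_0}-1}\sin(2n\arctan(\kappa r)),\qquad C_m(\kappa)=\sum_{n\ge1}\frac{n^m(-1)^n}{e^{n\kappa\beta_0}-1}\cos(2n\arctan(\kappa r)).$$ Let $D=\{\kappa:\ \mathrm{Re}\,\kappa>0,\ 2|\mathrm{Im}\arctan(\kappa r)|<\beta_0\,\mathrm{Re}\,\kappa\}$. (1) $D$ contains all $\kappa>0$, and for $\mathrm{Re}\,\kappa>0$ and every $m\ge 0$ each of the series $S_m$ and $C_m$ converges absolutely if and only if $\kappa\in D$. (2) As $\kappa\to0$ in $D$, up to an error $O(\kappa^N)$ for every $N$, $$S_0\sim-\frac{\arctan(r\kappa)}{\beta_0\kappa}+\frac{r\kappa}{4},\qquad C_1\sim-\frac1{2\beta_0\kappa}+\frac18+\frac{(r\kappa)^2}{8},\qquad S_2\sim-\frac{r\kappa}{8}-\frac{(r\kappa)^3}{8}.$$ (3) In the coordinates $(t,r,\theta,\varphi)$,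 $0<\theta<\pi$, of anti-de Sitter space-time with metric $$ds^2=(1+r^2\kappa^2)dt^2-(1+r^2\kappa^2)^{-1}dr^2-r^2(d\theta^2+\sin^2\theta\,d\varphi^2),$$ let $\beta^\mu=\beta_0(1,0,0,0)$, $u^\mu=\beta^\mu/\sqrt{\beta^2}$, $A_\mu=u^\nu\nabla_\nu u_\mu$, and let $T_{\mu\nu,\partial}$ be the boundary-condition-dependent term $$\begin{aligned}T_{\mu\nu,\partial}=\frac{\kappa^3}{8\pi^2r}\Bigl\{&\Bigl[\tfrac16\tfrac{1-\kappa^2r^2}{\kappa^2r^2}S_0-\tfrac1{3\kappa r}C_1-\tfrac23\tfrac1{1+\kappa^2r^2}S_2\Bigr]g_{\mu\nu}\\&+\Bigl[\tfrac16\bigl(3-\tfrac1{\kappa^2r^2}\bigr)S_0+\tfrac1{\kappa r}\bigl(1-\tfrac23\tfrac1{1+\kappa^2r^2}\bigr)C_1+\tfrac2{1+\kappa^2r^2}S_2\Bigr]u_\mu u_\nu\\&+\Bigl[\tfrac16\bigl(3\tfrac{1+\kappa^2r^2}{\kappa^2r^2}-4\bigr)S_0+\tfrac1{\kappa r}\bigl(\tfrac23\tfrac{\kappa^2r^2}{1+\kappa^2r^2}-1\bigr)C_1-\tfrac23\tfrac1{1+\kappa^2r^2}S_2\Bigr]\tfrac{1+r^2\kappa^2}{r^2\kappa^4}A_\mu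 A_\nu\Bigr\}.\end{aligned}$$ Then every component of $T_{\mu\nu,\partial}$ has an asymptotic power series with only odd powers of $\kappa$, $T_{\mu\nu,\partial}\sim\sum_{n\ge1}a_n\kappa^{2n+1}$ with real $a_n$, as $\kappa\to0$ in $D$. (4) As a function of $z=\kappa^2$ (with $\kappa=z^{1/2}$, $\mathrm{Re}\,\kappa>0$) on the domain $\{z: z^{1/2}\in D\}$, every component of $T_{\mu\nu,\partial}$ has analytic distillate $0$ at $z=0$, and any analytic distillate of it at $0$ vanishes near $0$: $$\mathrm{dist}_{\kappa^2=0}\,T_{\mu\nu,\partial}=0 .$$ Here, with the real powers of $z$ as transmonomials, the analytic distillate at $0$ of a function $f$ on a domain (a connected open set) having $0$ in its closure is obtained as follows: cover the domain by subsets accumulating at $0$ on each of which $f$ has an asymptotic expansion in real powers of $z$ (finitely many terms up to each order); take the coefficients of $z^n$, $n=0,1,2,\dots$, that are common to all the subsets (others being replaced by $0$); if the resulting power series has a positive radius of convergence, its sum is the distillate. -/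

import Mathlib

open Filter Topology Asymptotics

/-! ### The boundary series -/

/-- The `n`-th term of `S_m`, for complex `κ`. -/
noncomputable def sinTerm (β₀ r : ℝ) (m : ℕ) (κ : ℂ) (n : ℕ) : ℂ :=
  (n : ℂ) ^ m * (-1) ^ n / (Complex.exp (n * κ * β₀) - 1) *
    Complex.sin (2 * n * Complex.arctan (κ * r))

/-- The `n`-th term of `C_m`, for complex `κ`. -/
noncomputable def cosTerm (β₀ r : ℝ) (m : ℕ) (κ : ℂ) (n : ℕ) : ℂ :=
  (n : ℂ) ^ m * (-1) ^ n / (Complex.exp (n * κ * β₀) - 1) *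
    Complex.cos (2 * n * Complex.arctan (κ * r))

/-- `S_m = ∑_{n ≥ 1} n^m (-1)^n sin(2 n arctan(κ r)) / (e^{n κ β₀} - 1)`. -/
noncomputable def seriesS (β₀ r : ℝ) (m : ℕ) (κ : ℂ) : ℂ :=
  ∑' n : ℕ, sinTerm β₀ r m κ (n + 1)

/-- `C_m = ∑_{n ≥ 1} n^m (-1)^n cos(2 n arctan(κ r)) / (e^{n κ β₀} - 1)`. -/
noncomputable def seriesC (β₀ r : ℝ) (m : ℕ) (κ : ℂ) : ℂ :=
  ∑' n : ℕ, cosTerm β₀ r m κ (n + 1)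

/-- The region of the half-plane `Re κ > 0` where the terms of the boundary series decay. -/
def kappaDomain (β₀ r : ℝ) : Set ℂ :=
  {κ | 0 < κ.re ∧ 2 * |(Complex.arctan (κ * r)).im| < β₀ * κ.re}

/-- `f` and `g` have the same asymptotic expansion in powers of `κ` as `κ → 0` in `D`:
they differ by less than every power of `κ`. -/
def AsymptoticEq (D : Set ℂ) (f g : ℂ → ℂ) : Prop :=
  ∀ N : ℕ, (fun κ => f κ - g κ) =O[𝓝[D] 0] fun κ => κ ^ N

/-! ### Anti-de Sitter geometry in the coordinates `x = (t, r, θ, φ)`, signature `(+,-,-,-)` -/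

/-- The covariant components of the metric (complexified in `κ`). -/
noncomputable def adsMetric (κ : ℂ) (x : Fin 4 → ℝ) : Matrix (Fin 4) (Fin 4) ℂ :=
  Matrix.diagonal ![1 + (x 1 : ℂ) ^ 2 * κ ^ 2, -(1 + (x 1 : ℂ) ^ 2 * κ ^ 2)⁻¹,
    -(x 1 : ℂ) ^ 2, -((x 1 : ℂ) ^ 2 * (Real.sin (x 2) : ℂ) ^ 2)]

/-- The partial derivative in the `μ`-th coordinate. -/
noncomputable def coordDeriv (μ : Fin 4) (F : (Fin 4 → ℝ) → ℂ) (x : Fin 4 → ℝ) : ℂ :=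
  deriv (fun s : ℝ => F (Function.update x μ s)) (x μ)

/-- The Christoffel symbol `Γ^a_{μν}` of a metric given by its covariant components. -/
noncomputable def christoffel (g : (Fin 4 → ℝ) → Matrix (Fin 4) (Fin 4) ℂ) (x : Fin 4 → ℝ)
    (a μ ν : Fin 4) : ℂ :=
  (1 / 2) * ∑ b, (g x)⁻¹ a b *
    (coordDeriv μ (fun y => g y b ν) x + coordDeriv ν (fun y => g y b μ) x
      - coordDeriv b (fun y => g y μ ν) x)

/-- The four-temperature `β^μ = β₀ (1, 0, 0, 0)`. -/
def fourTemp (β₀ : ℝ) : Fin 4 → ℂ := ![(β₀ : ℂ), 0, 0, 0]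

/-- `β² = g_{μν} β^μ β^ν`. -/
noncomputable def fourTempSq (β₀ : ℝ) (κ : ℂ) (x : Fin 4 → ℝ) : ℂ :=
  ∑ μ, ∑ ν, adsMetric κ x μ ν * fourTemp β₀ μ * fourTemp β₀ ν

/-- The four-velocity `u^μ = β^μ / √β²`. -/
noncomputable def velocityUp (β₀ : ℝ) (κ : ℂ) (x : Fin 4 → ℝ) (μ : Fin 4) : ℂ :=
  fourTemp β₀ μ / fourTempSq β₀ κ x ^ (1 / 2 : ℂ)

/-- `u_μ = g_{μν} u^ν`. -/
noncomputable def velocity (β₀ : ℝ) (κ : ℂ) (x : Fin 4 → ℝ) (μ : Fin 4) : ℂ :=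
  ∑ ν, adsMetric κ x μ ν * velocityUp β₀ κ x ν

/-- The acceleration `A_μ = u^ν ∇_ν u_μ`. -/
noncomputable def acceleration (β₀ : ℝ) (κ : ℂ) (x : Fin 4 → ℝ) (μ : Fin 4) : ℂ :=
  ∑ ν, velocityUp β₀ κ x ν *
    (coordDeriv ν (fun y => velocity β₀ κ y μ) x
      - ∑ a, christoffel (adsMetric κ) x a ν μ * velocity β₀ κ x a)

/-- The boundary-condition-dependent term `T_{μν,∂}` of the stress-energy tensor of the massless
conformally coupled scalar field, in the coordinates `x = (t, r, θ, φ)`. -/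
noncomputable def boundaryT (β₀ : ℝ) (κ : ℂ) (x : Fin 4 → ℝ) (μ ν : Fin 4) : ℂ :=
  let r : ℂ := x 1
  let S₀ := seriesS β₀ (x 1) 0 κ
  let C₁ := seriesC β₀ (x 1) 1 κ
  let S₂ := seriesS β₀ (x 1) 2 κ
  κ ^ 3 / (8 * (Real.pi : ℂ) ^ 2 * r) *
    ((1 / 6 * ((1 - κ ^ 2 * r ^ 2) / (κ ^ 2 * r ^ 2)) * S₀
        - 1 / (3 * κ * r) * C₁
        - 2 / 3 * (1 / (1 + κ ^ 2 * r ^ 2)) * S₂) * adsMetric κ x μ ν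
      + (1 / 6 * (3 - 1 / (κ ^ 2 * r ^ 2)) * S₀
        + 1 / (κ * r) * (1 - 2 / 3 * (1 / (1 + κ ^ 2 * r ^ 2))) * C₁
        + 2 / (1 + κ ^ 2 * r ^ 2) * S₂) * (velocity β₀ κ x μ * velocity β₀ κ x ν)
      + (1 / 6 * (3 * ((1 + κ ^ 2 * r ^ 2) / (κ ^ 2 * r ^ 2)) - 4) * S₀
        + 1 / (κ * r) * (2 / 3 * (κ ^ 2 * r ^ 2 / (1 + κ ^ 2 * r ^ 2)) - 1) * C₁
        - 2 / 3 * (1 / (1 + κ ^ 2 * r ^ 2)) * S₂)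
        * ((1 + r ^ 2 * κ ^ 2) / (r ^ 2 * κ ^ 4))
        * (acceleration β₀ κ x μ * acceleration β₀ κ x ν))

/-! ### Analytic distillation -/

/-- A group of transmonomials in `z - z₀` on `D`, indexed by the additive group `E` of exponents
(`m e` is the transmonomial with exponent `e`) and containing the integer powers
`m (pow n) = (z - z₀)^n`. -/
structure IsTransmonomialGroup {E : Type} [AddCommGroup E] (m : E → ℂ → ℂ) (pow : ℤ → E)
    (D : Set ℂ) (z₀ : ℂ) : Prop where
  map_add : ∀ a b, ∀ z ∈ D, z ≠ z₀ → m (a + b) z = m a z * m b z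
  map_pow : ∀ n : ℤ, ∀ z ∈ D, z ≠ z₀ → m (pow n) z = (z - z₀) ^ n

/-- `f ∼ ∑ c e • m e` as `z → z₀` in `s`. Distinct transmonomials have distinct size on `s`, and for
every `n` only finitely many terms of the expansion are not `o((z - z₀)^n)`; subtracting them from
`f` leaves a remainder `o((z - z₀)^n)`. -/
structure HasTransseries {E : Type} (m : E → ℂ → ℂ) (s : Set ℂ) (z₀ : ℂ) (f : ℂ → ℂ)
    (c : E → ℂ) : Prop where
  comparable : ∀ a b, a ≠ b →
    m a =o[𝓝[s \ {z₀}] z₀] m b ∨ m b =o[𝓝[s \ {z₀}] z₀] m a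
  expansion : ∀ n : ℕ, ∃ F : Finset E,
    (∀ e, e ∈ F ↔ c e ≠ 0 ∧ ¬ m e =o[𝓝[s \ {z₀}] z₀] fun z => (z - z₀) ^ n) ∧
    (fun z => f z - ∑ e ∈ F, c e * m e z) =o[𝓝[s \ {z₀}] z₀] fun z => (z - z₀) ^ n

/-- `g` is the analytic distillate in `z₀` of `f`, a function on the domain `D`: on subsets
covering `D` and accumulating at `z₀`, `f` has transseries expansions, and `g` is near `z₀` the sum
of the convergent power series formed with the coefficients of the powers `(z - z₀)^n`, `n ≥ 0`,
that are common to all the subsets (a coefficient which is not common is replaced by `0`). -/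
def IsAnalyticDistillate {E : Type} [AddCommGroup E] (m : E → ℂ → ℂ) (pow : ℤ → E)
    (D : Set ℂ) (z₀ : ℂ) (f g : ℂ → ℂ) : Prop :=
  IsOpen D ∧ IsConnected D ∧ z₀ ∈ closure D ∧ IsTransmonomialGroup m pow D z₀ ∧
  ∃ (ι : Type) (_ : Nonempty ι) (s : ι → Set ℂ) (c : ι → E → ℂ) (a : ℕ → ℂ),
    (⋃ i, s i) = D ∧
    (∀ i, AccPt z₀ (𝓟 (s i)) ∧ HasTransseries m (s i) z₀ f (c i)) ∧
    (∀ n : ℕ, (∀ i, c i (pow n) = a n) ∨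
      (a n = 0 ∧ ∃ i j, c i (pow n) ≠ c j (pow n))) ∧
    HasFPowerSeriesAt g (FormalMultilinearSeries.ofScalars ℂ a) z₀

/-- The real powers of `z` (principal branch), as transmonomials at `0`. -/
noncomputable def realPower (e : ℝ) (z : ℂ) : ℂ := z ^ (e : ℂ)

/-- The domain of the variable `z = κ²`, where `κ = z^(1/2)` is the root with `Re κ > 0`. -/
def kappaSqDomain (β₀ r : ℝ) : Set ℂ := {z | z ^ (1 / 2 : ℂ) ∈ kappaDomain β₀ r}

/-! ### Euler–Maclaurin summation -/

/-! Put `h = κ β₀`, `a = 2 i arctan (κ r)` and `F(w) = -1/(e^w + 1)`. Write the trigonometric factor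
through `e^(±na)` and expand `1/(e^(nh) - 1)` as a geometric series in `e^(-nh)`. In `D` the
resulting double series converges absolutely. Summing over `n` first turns `S_0`, `C_1`, `S_2` into
constants times `∑_{k ≥ 1} φ(kh)`, where `φ(x) = F^(m)(x - a) - (-1)^m F^(m)(x + a)` (`seriesS_eq`,
`seriesC_eq`).

To this sum Euler–Maclaurin summation applies. The symmetry `F(-w) = -1 - F(w)` makes every odd
derivative of `φ` vanish at `0`, and the odd Bernoulli numbers beyond the first are `0`. Hence only
the integral and the half value `φ(0)/2` survive, up to any power of `h`
(`EulerMaclaurinChain.hasSum_pairing`, `fermi_sum_expansion`). The error is uniform because `D` lies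
in a sector `|Im κ| ≤ K Re κ` near `0` (`eventually_kappaDomain_sector`), where the poles of `F`
stay away. Since `e^a = (1 + iq)/(1 - iq)` with `q = κ r`, the value `F(a) = -(1 - iq)/2` is linear
in `q`. All surviving terms are therefore polynomials in `q`, except for the arctangent that the
antiderivative `log (1 + e^(-w))` of `F` contributes to `S_0`.

Outside `D` the terms do not tend to `0`, which settles convergence (`mem_kappaDomain_of_tendsto`).

For the tensor, `u` has only a `t`-component and `A` only an `r`-component, so three kinds of
components remain. In each, the parts of the expansions without `1/β₀`, which would give even powers
of `κ`, cancel identically. The parts with `1/β₀` combine to `κ³` times a real power series in `κ²`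
(`boundaryT_expansion`). In `z = κ²` these are powers `z^(k + 1/2)` only. Expansions in real powers
are unique on any set accumulating at `0` (`HasTransseries.unique`), so no covering produces a
nonzero coefficient of an integer power. -/

/-- The pairing of `f` on `[k, k + 1]` with the normalised Bernoulli polynomial `B_j / j!`. -/
noncomputable def bernoulliPairing (j : ℕ) (f : ℝ → ℂ) (k : ℕ) : ℂ :=
  ∫ x in (0 : ℝ)..1, f (k + x) * ((bernoulliFun j x / j.factorial : ℝ) : ℂ)

theorem hasDerivAt_bernoulliFun_div_factorial (j : ℕ) (x : ℝ) :
    HasDerivAt (fun x : ℝ => ((bernoulliFun (j + 1) x / (j + 1).factorial : ℝ) : ℂ))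
      ((bernoulliFun j x / j.factorial : ℝ) : ℂ) x := by
  have h := (hasDerivAt_bernoulliFun (j + 1) x).div_const ((j + 1).factorial : ℝ)
  convert! h.ofReal_comp using 2
  have h1 : (j.factorial : ℝ) ≠ 0 := by positivity
  have h2 : (j + 1 : ℝ) ≠ 0 := by positivity
  rw [Nat.factorial_succ]
  push_cast
  field_simp

theorem exists_bernoulliFun_div_factorial_bound (j : ℕ) :
    ∃ B : ℝ, 0 ≤ B ∧ ∀ x ∈ Set.Icc (0 : ℝ) 1,
      ‖((bernoulliFun j x / j.factorial : ℝ) : ℂ)‖ ≤ B := by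
  have hc : Continuous fun x : ℝ => ((bernoulliFun j x / j.factorial : ℝ) : ℂ) := by
    have := continuous_bernoulliFun j
    fun_prop
  obtain ⟨B, hB⟩ := isCompact_Icc.exists_bound_of_continuousOn (s := Set.Icc (0 : ℝ) 1)
    hc.continuousOn
  exact ⟨B, (norm_nonneg _).trans (hB 0 (by simp)), hB⟩

theorem bernoulliPairing_norm_le {j : ℕ} {B A : ℝ} {f : ℝ → ℂ} {k : ℕ}
    (hB : ∀ x ∈ Set.Icc (0 : ℝ) 1, ‖((bernoulliFun j x / j.factorial : ℝ) : ℂ)‖ ≤ B)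
    (hf : ∀ x ∈ Set.Icc (0 : ℝ) 1, ‖f (k + x)‖ ≤ A) :
    ‖bernoulliPairing j f k‖ ≤ B * A := by
  have h := intervalIntegral.norm_integral_le_of_norm_le_const (a := (0 : ℝ)) (b := 1)
    (C := B * A) (f := fun x : ℝ => f (k + x) * ((bernoulliFun j x / j.factorial : ℝ) : ℂ)) ?_
  · simpa [bernoulliPairing] using h
  · intro x hx
    rw [Set.uIoc_of_le zero_le_one] at hx
    have hx' : x ∈ Set.Icc (0 : ℝ) 1 := ⟨hx.1.le, hx.2⟩
    rw [norm_mul, mul_comm]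
    exact mul_le_mul (hB x hx') (hf x hx') (norm_nonneg _) ((norm_nonneg _).trans (hB x hx'))

/-- Integration by parts on `[k, k + 1]`: the normalised Bernoulli polynomials are successive
antiderivatives of each other. -/
theorem bernoulliPairing_eq_sub {f f' : ℝ → ℂ}
    (hf : ∀ x : ℝ, 0 ≤ x → HasDerivAt f (f' x) x)
    (hf' : ∀ x : ℝ, 0 ≤ x → ContinuousAt f' x) (j k : ℕ) :
    bernoulliPairing j f k =
      f (k + 1) * ((bernoulliFun (j + 1) 1 / (j + 1).factorial : ℝ) : ℂ)
      - f k * ((bernoulliFun (j + 1) 0 / (j + 1).factorial : ℝ) : ℂ)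
      - bernoulliPairing (j + 1) f' k := by
  have hd : ∀ x ∈ Set.uIcc (0 : ℝ) 1,
      HasDerivAt (fun y : ℝ => f (k + y)) (f' (k + x)) x := by
    intro x hx
    rw [Set.uIcc_of_le zero_le_one] at hx
    have h := hf (k + x) (add_nonneg k.cast_nonneg hx.1)
    simpa using h.comp_const_add (k : ℝ) x
  have h := intervalIntegral.integral_mul_deriv_eq_deriv_mul hd
    (fun x _ => hasDerivAt_bernoulliFun_div_factorial j x) ?_ ?_
  · simpa [bernoulliPairing] using h
  · refine ContinuousOn.intervalIntegrable fun x hx => ?_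
    rw [Set.uIcc_of_le zero_le_one] at hx
    have h := hf' (k + x) (add_nonneg k.cast_nonneg hx.1)
    exact (ContinuousAt.comp (f := fun y : ℝ => (k : ℝ) + y) h
      (by fun_prop)).continuousWithinAt
  · have := continuous_bernoulliFun j
    exact Continuous.intervalIntegrable (by fun_prop) _ _

theorem bernoulliPairing_zero {f f' : ℝ → ℂ}
    (hf : ∀ x : ℝ, 0 ≤ x → HasDerivAt f (f' x) x)
    (hf' : ∀ x : ℝ, 0 ≤ x → ContinuousAt f' x) (k : ℕ) :
    bernoulliPairing 0 f' k = f (k + 1) - f k := by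
  have hd : ∀ x ∈ Set.uIcc (0 : ℝ) 1,
      HasDerivAt (fun y : ℝ => f (k + y)) (f' (k + x)) x := by
    intro x hx
    rw [Set.uIcc_of_le zero_le_one] at hx
    have h := hf (k + x) (add_nonneg k.cast_nonneg hx.1)
    simpa using h.comp_const_add (k : ℝ) x
  have h := intervalIntegral.integral_eq_sub_of_hasDerivAt hd ?_
  · simpa [bernoulliPairing] using h
  · refine ContinuousOn.intervalIntegrable fun x hx => ?_
    rw [Set.uIcc_of_le zero_le_one] at hx
    have h := hf' (k + x) (add_nonneg k.cast_nonneg hx.1)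
    exact (ContinuousAt.comp (f := fun y : ℝ => (k : ℝ) + y) h
      (by fun_prop)).continuousWithinAt

/-- One factor always vanishes: the Bernoulli number for even `j`, its index `j + 1` being odd and
at least `3`, and `g` for odd `j`. This removes all higher Euler–Maclaurin corrections. -/
theorem mul_bernoulliFun_zero_eq_zero {g : ℂ} (j : ℕ) :
    (j ≠ 0) → (Odd j → g = 0) →
    g * ((bernoulliFun (j + 1) 0 / (j + 1).factorial : ℝ) : ℂ) = 0 := by
  intro hj hg
  rcases Nat.even_or_odd j with h | h
  · have hb : bernoulliFun (j + 1) 0 = 0 := by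
      rw [bernoulliFun_eval_zero, bernoulli_eq_zero_of_odd h.add_one (by omega)]
      simp
    simp [hb]
  · simp [hg h]

/-- Data for Euler–Maclaurin summation of `f 1` on `[0, ∞)`: a chain `f j` of successive
derivatives with exponential decay, the antiderivative `f 0` vanishing at infinity, and the odd
derivatives of `f 1` vanishing at `0`. -/
structure EulerMaclaurinChain (f : ℕ → ℝ → ℂ) (M : ℕ → ℝ) (c : ℝ) : Prop where
  pos : 0 < c
  deriv : ∀ j (x : ℝ), 0 ≤ x → HasDerivAt (f j) (f (j + 1) x) x
  bound : ∀ j (x : ℝ), 0 ≤ x → ‖f (j + 1) x‖ ≤ M (j + 1) * Real.exp (-(c * x))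
  tendsto : Tendsto (fun k : ℕ => f 0 k) atTop (𝓝 0)
  odd_zero : ∀ j, f (2 * (j + 1)) 0 = 0

namespace EulerMaclaurinChain

variable {f : ℕ → ℝ → ℂ} {M : ℕ → ℝ} {c : ℝ}

theorem nonneg (H : EulerMaclaurinChain f M c) (j : ℕ) : 0 ≤ M (j + 1) := by
  have h := (norm_nonneg _).trans (H.bound j 0 le_rfl)
  simpa using h

theorem hasSum_geometric (H : EulerMaclaurinChain f M c) :
    HasSum (fun k : ℕ => Real.exp (-(c * k))) (1 - Real.exp (-c))⁻¹ := by
  have h := hasSum_geometric_of_lt_one (Real.exp_pos (-c)).le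
    (Real.exp_lt_one_iff.2 (neg_lt_zero.2 H.pos))
  refine h.congr_fun fun k => ?_
  rw [← Real.exp_nat_mul]
  ring_nf

theorem summable (H : EulerMaclaurinChain f M c) (j : ℕ) :
    Summable fun k : ℕ => f (j + 1) k :=
  Summable.of_norm_bounded (H.hasSum_geometric.summable.mul_left (M (j + 1)))
    fun k => H.bound j k k.cast_nonneg

theorem pairing_norm_le (H : EulerMaclaurinChain f M c) {i : ℕ} (j : ℕ) {B : ℝ}
    (hB : ∀ x ∈ Set.Icc (0 : ℝ) 1, ‖((bernoulliFun i x / i.factorial : ℝ) : ℂ)‖ ≤ B) (k : ℕ) :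
    ‖bernoulliPairing i (f (j + 1)) k‖ ≤ B * M (j + 1) * Real.exp (-(c * k)) := by
  rw [mul_assoc]
  refine bernoulliPairing_norm_le hB fun x hx => ?_
  refine (H.bound j _ (add_nonneg k.cast_nonneg hx.1)).trans ?_
  refine mul_le_mul_of_nonneg_left (Real.exp_le_exp.2 ?_) (H.nonneg j)
  have := mul_nonneg H.pos.le hx.1
  linarith

theorem summable_pairing (H : EulerMaclaurinChain f M c) (i j : ℕ) :
    Summable fun k : ℕ => bernoulliPairing i (f (j + 1)) k := by
  obtain ⟨B, -, hB⟩ := exists_bernoulliFun_div_factorial_bound i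
  exact Summable.of_norm_bounded (H.hasSum_geometric.summable.mul_left (B * M (j + 1)))
    (H.pairing_norm_le j hB)

/-- Each integration by parts flips the sign and raises the order of the remainder, while its
telescoped boundary term is zero. So the same quantity is expressed by remainders of every order. -/
theorem hasSum_pairing (H : EulerMaclaurinChain f M c) (N : ℕ) :
    HasSum (fun k => bernoulliPairing (N + 1) (f (N + 2)) k)
      ((-1) ^ N * ((∑' k : ℕ, f 1 (k + 1)) + f 0 0 + f 1 0 / 2)) := by
  have hshift : ∀ j, HasSum (fun k : ℕ => f (j + 1) (k + 1))
      ((∑' k : ℕ, f (j + 1) k) - f (j + 1) 0) := by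
    intro j
    have h := (hasSum_nat_add_iff' 1).2 (H.summable j).hasSum
    simpa using h
  have hcont : ∀ j (x : ℝ), 0 ≤ x → ContinuousAt (f j) x := fun j x hx =>
    (H.deriv j x hx).continuousAt
  induction N with
  | zero =>
    have h0 : HasSum (fun k => bernoulliPairing 0 (f 1) k) (-f 0 0) := by
      refine (H.summable_pairing 0 0).hasSum_iff_tendsto_nat.2 ?_
      have : ∀ n : ℕ, ∑ k ∈ Finset.range n, bernoulliPairing 0 (f 1) k = f 0 n - f 0 0 := by
        intro n
        have h := Finset.sum_range_sub (fun k : ℕ => f 0 (k : ℝ)) n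
        simp only [Nat.cast_zero] at h
        rw [← h]
        refine Finset.sum_congr rfl fun k _ => ?_
        rw [bernoulliPairing_zero (H.deriv 0) (hcont 1)]
        push_cast
        rfl
      simp only [this]
      simpa using H.tendsto.sub_const (f 0 0)
    -- The first Bernoulli polynomial takes the values `-1/2` and `1/2` at the endpoints, so these
    -- boundary terms add up to the trapezoidal sum instead of telescoping.
    have h1 := ((hshift 0).mul_right (1 / 2 : ℂ)).add ((H.summable 0).hasSum.mul_right (1 / 2 : ℂ))
    have h2 := h1.sub h0
    convert! h2 using 1
    · ext k
      have h := bernoulliPairing_eq_sub (H.deriv 1) (hcont 2) 0 k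
      rw [h]
      simp
      norm_num
    · rw [(hshift 0).tsum_eq]
      ring
  | succ N ih =>
    -- From index `2` on the endpoint values of the Bernoulli polynomials agree; the boundary terms
    -- telescope to a single term at `0`, which is killed by `hz`.
    have h1 := ((hshift (N + 1)).mul_right
      (((bernoulliFun (N + 2) 0 / (N + 2).factorial : ℝ) : ℂ))).sub
      ((H.summable (N + 1)).hasSum.mul_right
      (((bernoulliFun (N + 2) 0 / (N + 2).factorial : ℝ) : ℂ)))
    have hz : f (N + 2) 0 * ((bernoulliFun (N + 2) 0 / (N + 2).factorial : ℝ) : ℂ) = 0 := by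
      refine mul_bernoulliFun_zero_eq_zero (N + 1) (by omega) fun h => ?_
      obtain ⟨i, hi⟩ := h
      have := H.odd_zero i
      rwa [show 2 * (i + 1) = N + 2 by omega] at this
    have h2 := h1.sub ih
    convert! h2 using 1
    · ext k
      have h := bernoulliPairing_eq_sub (H.deriv (N + 2)) (hcont (N + 3)) (N + 1) k
      rw [bernoulliFun_endpoints_eq_of_ne_one (by omega : N + 1 + 1 ≠ 1)] at h
      rw [h]
      ring
    · rw [sub_mul, hz]
      ring

theorem norm_tsum_add_le (H : EulerMaclaurinChain f M c) (N : ℕ) {B : ℝ}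
    (hB : ∀ x ∈ Set.Icc (0 : ℝ) 1,
      ‖((bernoulliFun (N + 1) x / (N + 1).factorial : ℝ) : ℂ)‖ ≤ B) :
    ‖(∑' k : ℕ, f 1 (k + 1)) + f 0 0 + f 1 0 / 2‖ ≤
      B * M (N + 2) * (1 - Real.exp (-c))⁻¹ := by
  have h1 := tsum_of_norm_bounded (H.hasSum_geometric.mul_left (B * M (N + 2)))
    (H.pairing_norm_le (N + 1) hB)
  rw [(H.hasSum_pairing N).tsum_eq, norm_mul, norm_pow, norm_neg, norm_one, one_pow, one_mul] at h1
  exact h1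

end EulerMaclaurinChain

/-! ### The Fermi function and its derivatives -/

/-- The function `F(w) = -1 / (e^w + 1)`. -/
noncomputable def fermi (w : ℂ) : ℂ := -(Complex.exp w + 1)⁻¹

/-- The polynomial `P` with `F^(j) = P(F)`. -/
noncomputable def fermiPoly : ℕ → Polynomial ℂ
  | 0 => Polynomial.X
  | j + 1 => -(Polynomial.X * (1 + Polynomial.X)) * Polynomial.derivative (fermiPoly j)

/-- The antiderivative `log (1 + e^(-w))` of `F`, followed by `F` and its derivatives. -/
noncomputable def fermiDeriv : ℕ → ℂ → ℂ
  | 0 => fun w => Complex.log (1 + Complex.exp (-w))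
  | j + 1 => fun w => (fermiPoly j).eval (fermi w)

/-- A neighbourhood of a sector around the positive real axis. -/
def fermiRegion (K : ℝ) : Set ℂ := {w | |w.im| ≤ K * w.re + 1}

theorem exp_add_one_eq (w : ℂ) :
    Complex.exp w + 1 = Complex.exp w * (1 + Complex.exp (-w)) := by
  rw [mul_add, ← Complex.exp_add]
  simp

/-- Either `|Im w| ≤ π/2` and the cosine is nonnegative, or `Re w` is bounded below by a positive
number and `e^(-w)` is strictly smaller than `1` in modulus. -/
theorem exists_le_re_one_add_exp_neg {K : ℝ} (hK : 0 < K) :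
    ∃ c : ℝ, 0 < c ∧ ∀ w ∈ fermiRegion K, c ≤ (1 + Complex.exp (-w)).re := by
  have hlt : Real.exp (-(1 / (2 * K))) < 1 := by
    rw [Real.exp_lt_one_iff]
    have : 0 < 1 / (2 * K) := by positivity
    linarith
  refine ⟨1 - Real.exp (-(1 / (2 * K))), by linarith, fun w hw => ?_⟩
  have hw' : |w.im| ≤ K * w.re + 1 := hw
  rw [Complex.add_re, Complex.one_re, Complex.exp_re, Complex.neg_re, Complex.neg_im, Real.cos_neg]
  have hpi := Real.pi_gt_three
  rcases le_or_gt |w.im| (Real.pi / 2) with h | h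
  · have h1 : 0 ≤ Real.cos w.im :=
      Real.cos_nonneg_of_neg_pi_div_two_le_of_le (abs_le.1 h).1 (abs_le.1 h).2
    have h2 := mul_nonneg (Real.exp_pos (-w.re)).le h1
    have h3 := Real.exp_pos (-(1 / (2 * K)))
    linarith
  · have h1 : 1 / (2 * K) ≤ w.re := by
      rw [div_le_iff₀ (by positivity)]
      nlinarith
    have h2 : Real.exp (-w.re) ≤ Real.exp (-(1 / (2 * K))) := Real.exp_le_exp.2 (by linarith)
    have h3 := Real.neg_one_le_cos w.im
    have h4 := Real.exp_pos (-w.re)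
    nlinarith

theorem hasDerivAt_fermi {w : ℂ} (hw : Complex.exp w + 1 ≠ 0) :
    HasDerivAt fermi (-(fermi w * (1 + fermi w))) w := by
  have h := (((Complex.hasDerivAt_exp w).add_const 1).inv hw).neg
  convert! h using 1
  rw [fermi]
  field_simp
  ring

theorem hasDerivAt_fermiDeriv {w : ℂ} (hw : 0 < (1 + Complex.exp (-w)).re) (j : ℕ) :
    HasDerivAt (fermiDeriv j) (fermiDeriv (j + 1) w) w := by
  have h0 : 1 + Complex.exp (-w) ≠ 0 := by
    intro h
    rw [h] at hw
    simp at hw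
  have h1 : Complex.exp w + 1 ≠ 0 := by
    rw [exp_add_one_eq]
    exact mul_ne_zero (Complex.exp_ne_zero _) h0
  cases j with
  | zero =>
    have h := (((hasDerivAt_neg w).cexp).const_add 1).clog (Or.inl hw)
    convert! h using 1
    simp only [fermiDeriv, fermiPoly, Polynomial.eval_X, fermi]
    rw [exp_add_one_eq, mul_inv, ← Complex.exp_neg]
    field_simp
  | succ j =>
    have h := ((fermiPoly j).hasDerivAt (fermi w)).comp w (hasDerivAt_fermi h1)
    convert! h using 1
    simp [fermiDeriv, fermiPoly]
    ring

theorem X_dvd_fermiPoly (j : ℕ) : Polynomial.X ∣ fermiPoly j := by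
  cases j with
  | zero => exact dvd_rfl
  | succ j =>
    refine Dvd.dvd.mul_right ?_ _
    rw [dvd_neg]
    exact dvd_mul_right _ _

/-- The derivative is a polynomial in `F` without constant term. One factor `F` gives the decay; the
cofactor is bounded because `Re w ≥ -1/K` confines `F` to a ball. -/
theorem exists_fermiDeriv_bound {K : ℝ} (hK : 0 < K) (j : ℕ) :
    ∃ C : ℝ, 0 ≤ C ∧ ∀ w ∈ fermiRegion K, ‖fermiDeriv (j + 1) w‖ ≤ C * Real.exp (-w.re) := by
  obtain ⟨c, hc, hcw⟩ := exists_le_re_one_add_exp_neg hK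
  obtain ⟨Q, hQ⟩ := X_dvd_fermiPoly j
  obtain ⟨C, hC⟩ := (isCompact_closedBall (0 : ℂ) (c⁻¹ * Real.exp (1 / K))).exists_bound_of_continuousOn
    (f := fun z => Q.eval z) Q.continuous.continuousOn
  have hfermi : ∀ w ∈ fermiRegion K, ‖fermi w‖ ≤ c⁻¹ * Real.exp (-w.re) := by
    intro w hw
    have h := (hcw w hw).trans (Complex.re_le_norm _)
    rw [fermi, exp_add_one_eq, norm_neg, mul_inv, ← Complex.exp_neg, norm_mul, norm_inv,
      Complex.norm_exp, Complex.neg_re, mul_comm]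
    gcongr
  refine ⟨C * c⁻¹, ?_, fun w hw => ?_⟩
  · have : 0 ≤ C := (norm_nonneg _).trans (hC 0 (by simp; positivity))
    positivity
  · have hre : -w.re ≤ 1 / K := by
      have h1 : |w.im| ≤ K * w.re + 1 := hw
      have h2 := (abs_nonneg _).trans h1
      rw [le_div_iff₀ hK]
      linarith
    have hball : fermi w ∈ Metric.closedBall (0 : ℂ) (c⁻¹ * Real.exp (1 / K)) := by
      rw [mem_closedBall_zero_iff]
      refine (hfermi w hw).trans ?_
      gcongr
    have h3 := hC _ hball
    simp only [fermiDeriv, hQ, Polynomial.eval_mul, Polynomial.eval_X, norm_mul]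
    rw [mul_comm, mul_assoc]
    exact mul_le_mul h3 (hfermi w hw) (norm_nonneg _) ((norm_nonneg _).trans h3)

/-- This is the parity of the derivatives of `F`, stated on polynomials: `w ↦ -w` acts on `F` as `X
↦ -1 - X`, which preserves `X (1 + X)`. -/
theorem fermiPoly_reflect (j : ℕ) :
    (fermiPoly (j + 1)).comp (-1 - Polynomial.X) = (-1) ^ j * fermiPoly (j + 1) := by
  induction j with
  | zero => simp [fermiPoly]; ring
  | succ j ih =>
    have h := congrArg Polynomial.derivative ih
    have hd : Polynomial.derivative ((-1 : Polynomial ℂ) ^ j) = 0 := by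
      rw [show (-1 : Polynomial ℂ) ^ j = Polynomial.C ((-1) ^ j) by simp]
      exact Polynomial.derivative_C
    rw [Polynomial.derivative_comp, Polynomial.derivative_mul, hd] at h
    simp only [Polynomial.derivative_sub, Polynomial.derivative_neg, Polynomial.derivative_one,
      Polynomial.derivative_X] at h
    rw [fermiPoly, Polynomial.mul_comp]
    simp only [Polynomial.neg_comp, Polynomial.mul_comp, Polynomial.X_comp, Polynomial.add_comp,
      Polynomial.one_comp]
    linear_combination (Polynomial.X * (1 + Polynomial.X)) * h

theorem fermi_neg {w : ℂ} (hw : Complex.exp w + 1 ≠ 0) : fermi (-w) = -1 - fermi w := by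
  have h := Complex.exp_ne_zero w
  rw [fermi, fermi, Complex.exp_neg]
  generalize Complex.exp w = x at hw h
  have hx : x⁻¹ + 1 = (x + 1) / x := by
    field_simp
    ring
  rw [hx]
  field_simp
  ring

theorem fermiDeriv_neg {w : ℂ} (hw : Complex.exp w + 1 ≠ 0) (j : ℕ) :
    fermiDeriv (j + 2) (-w) = (-1) ^ j * fermiDeriv (j + 2) w := by
  have h := congrArg (Polynomial.eval (fermi w)) (fermiPoly_reflect j)
  simpa [fermiDeriv, fermi_neg hw] using h

theorem tendsto_fermiDeriv {ι : Type*} {l : Filter ι} {w : ι → ℂ}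
    (hw : Tendsto (fun i => (w i).re) l atTop) (m : ℕ) :
    Tendsto (fun i => fermiDeriv m (w i)) l (𝓝 0) := by
  have h1 : Tendsto (fun i => Complex.exp (-w i)) l (𝓝 0) := by
    rw [tendsto_zero_iff_norm_tendsto_zero]
    simp only [Complex.norm_exp, Complex.neg_re]
    exact Real.tendsto_exp_neg_atTop_nhds_zero.comp hw
  cases m with
  | zero =>
    have h2 : ContinuousAt Complex.log (1 + 0) := continuousAt_clog (by simp)
    simpa [fermiDeriv, Function.comp_def] using h2.tendsto.comp (h1.const_add 1)
  | succ j =>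
    have h2 : Tendsto (fun i => fermi (w i)) l (𝓝 0) := by
      have h3 := (h1.mul ((h1.const_add 1).inv₀ (by simp))).neg
      simp only [zero_mul, neg_zero] at h3
      refine h3.congr fun i => ?_
      rw [fermi, exp_add_one_eq, mul_inv, ← Complex.exp_neg]
    have h4 := (fermiPoly j).continuous.continuousAt.tendsto.comp h2
    have h5 : (fermiPoly j).eval 0 = 0 := by
      obtain ⟨Q, hQ⟩ := X_dvd_fermiPoly j
      simp [hQ]
    rw [h5] at h4
    exact h4

/-! ### Euler–Maclaurin summation of the derivatives of the Fermi function -/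

/-- The combination of shifted derivatives of the Fermi function whose sum over `x = 1, 2, …`
occurs in the boundary series. -/
noncomputable def fermiChain (m : ℕ) (h a : ℂ) (j : ℕ) (x : ℝ) : ℂ :=
  h ^ j * (fermiDeriv (m + j) (x * h - a) - (-1) ^ m * fermiDeriv (m + j) (x * h + a))

/-- The point `x h` lies in the sector, and shifting by `a` costs at most `(K + 1) ‖a‖`, which is
the slack `1` in `fermiRegion`. -/
theorem mem_fermiRegion {K : ℝ} (hK : 0 < K) {h a : ℂ} (him : |h.im| ≤ K * h.re)
    (ha : (K + 1) * ‖a‖ ≤ 1) {x : ℝ} (hx : 0 ≤ x) : x * h + a ∈ fermiRegion K := by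
  have h1 := (abs_le.1 (Complex.abs_re_le_norm a)).1
  have h2 := Complex.abs_im_le_norm a
  have h3 : |x * h.im + a.im| ≤ x * |h.im| + |a.im| := by
    refine (abs_add_le _ _).trans ?_
    rw [abs_mul, abs_of_nonneg hx]
  have h4 := mul_le_mul_of_nonneg_left him hx
  simp only [fermiRegion, Set.mem_ofPred_eq, Complex.add_im, Complex.add_re, Complex.mul_im,
    Complex.mul_re, Complex.ofReal_re, Complex.ofReal_im, zero_mul, add_zero, sub_zero]
  nlinarith

/-- In the bound, `2` counts the shifts by `±a` and `Real.exp 1` absorbs `|Re a| ≤ 1`. The truncated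
`m + j - 1` is harmless, since only indices `j ≥ 1` of `M` are used. -/
theorem fermiChain_eulerMaclaurin {K : ℝ} (hK : 0 < K) {C : ℕ → ℝ}
    (hC : ∀ j, 0 ≤ C j ∧ ∀ w ∈ fermiRegion K, ‖fermiDeriv (j + 1) w‖ ≤ C j * Real.exp (-w.re))
    (m : ℕ) {h a : ℂ} (hre : 0 < h.re) (him : |h.im| ≤ K * h.re) (ha : (K + 1) * ‖a‖ ≤ 1) :
    EulerMaclaurinChain (fermiChain m h a)
      (fun j => ‖h‖ ^ j * (2 * Real.exp 1 * C (m + j - 1))) h.re := by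
  obtain ⟨c, hc, hcw⟩ := exists_le_re_one_add_exp_neg hK
  have hna : (K + 1) * ‖-a‖ ≤ 1 := by rwa [norm_neg]
  have hplus : ∀ x : ℝ, 0 ≤ x → x * h + a ∈ fermiRegion K := fun x hx =>
    mem_fermiRegion hK him ha hx
  have hminus : ∀ x : ℝ, 0 ≤ x → x * h - a ∈ fermiRegion K := fun x hx => by
    rw [sub_eq_add_neg]
    exact mem_fermiRegion hK him hna hx
  have hare : |a.re| ≤ 1 := by
    have h1 := Complex.abs_re_le_norm a
    nlinarith [norm_nonneg a]
  obtain ⟨hare1, hare2⟩ := abs_le.1 hare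
  refine ⟨hre, fun j x hx => ?_, fun j x hx => ?_, ?_, fun j => ?_⟩
  · have hlin : HasDerivAt (fun y : ℝ => (y : ℂ) * h) h x := by
      simpa using (Complex.ofRealCLM.hasDerivAt (x := x)).mul_const h
    have h1 := (hasDerivAt_fermiDeriv (hc.trans_le (hcw _ (hminus x hx))) (m + j)).comp x
      (hlin.sub_const a)
    have h2 := (hasDerivAt_fermiDeriv (hc.trans_le (hcw _ (hplus x hx))) (m + j)).comp x
      (hlin.add_const a)
    convert! (h1.sub (h2.const_mul ((-1) ^ m))).const_mul (h ^ j) using 1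
    simp only [fermiChain, ← add_assoc]
    ring
  · have h1 := (hC (m + j)).2 _ (hminus x hx)
    have h2 := (hC (m + j)).2 _ (hplus x hx)
    have e1 : Real.exp (-((x : ℂ) * h - a).re) ≤ Real.exp 1 * Real.exp (-(h.re * x)) := by
      rw [← Real.exp_add, Real.exp_le_exp]
      simp only [Complex.sub_re, Complex.re_ofReal_mul]
      linarith
    have e2 : Real.exp (-((x : ℂ) * h + a).re) ≤ Real.exp 1 * Real.exp (-(h.re * x)) := by
      rw [← Real.exp_add, Real.exp_le_exp]
      simp only [Complex.add_re, Complex.re_ofReal_mul]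
      linarith
    have f1 := h1.trans (mul_le_mul_of_nonneg_left e1 (hC (m + j)).1)
    have f2 := h2.trans (mul_le_mul_of_nonneg_left e2 (hC (m + j)).1)
    rw [fermiChain, norm_mul, norm_pow, mul_assoc, ← add_assoc, Nat.add_sub_cancel]
    refine mul_le_mul_of_nonneg_left ?_ (by positivity)
    refine (norm_sub_le _ _).trans ?_
    rw [norm_mul, norm_pow, norm_neg, norm_one, one_pow, one_mul]
    linarith
  · have hk : Tendsto (fun k : ℕ => (k : ℝ) * h.re) atTop atTop :=
      tendsto_natCast_atTop_atTop.atTop_mul_const hre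
    have h1 : Tendsto (fun k : ℕ => (((k : ℝ) : ℂ) * h - a).re) atTop atTop := by
      simp only [Complex.sub_re, Complex.re_ofReal_mul]
      exact tendsto_atTop_add_const_right _ _ hk
    have h2 : Tendsto (fun k : ℕ => (((k : ℝ) : ℂ) * h + a).re) atTop atTop := by
      simp only [Complex.add_re, Complex.re_ofReal_mul]
      exact tendsto_atTop_add_const_right _ _ hk
    have h3 := (tendsto_fermiDeriv h1 m).sub ((tendsto_fermiDeriv h2 m).const_mul ((-1) ^ m))
    simpa [fermiChain] using h3
  · have hne : Complex.exp a + 1 ≠ 0 := by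
      have h1 := hcw _ (hplus 0 le_rfl)
      simp only [Complex.ofReal_zero, zero_mul, zero_add] at h1
      rw [exp_add_one_eq]
      refine mul_ne_zero (Complex.exp_ne_zero _) fun h2 => ?_
      rw [h2, Complex.zero_re] at h1
      linarith
    -- The reflection sign is `(-1)^m`, exactly the sign in `fermiChain`, so the two shifted terms
    -- cancel at `x = 0`.
    have h2 := fermiDeriv_neg hne (m + 2 * j)
    rw [pow_add, pow_mul] at h2
    simp only [fermiChain, Complex.ofReal_zero, zero_mul, zero_add, zero_sub]
    rw [show m + 2 * (j + 1) = m + 2 * j + 2 by ring, h2]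
    simp

theorem fermi_sum_expansion {K : ℝ} (hK : 0 < K) (m N : ℕ) :
    ∃ A : ℝ, ∀ h a : ℂ, 0 < h.re → h.re ≤ 1 → |h.im| ≤ K * h.re → (K + 1) * ‖a‖ ≤ 1 →
      ‖h * (∑' k : ℕ, (fermiDeriv (m + 1) ((k + 1 : ℕ) * h - a)
            - (-1) ^ m * fermiDeriv (m + 1) ((k + 1 : ℕ) * h + a)))
          + (fermiDeriv m (-a) - (-1) ^ m * fermiDeriv m a)
          + h / 2 * (fermiDeriv (m + 1) (-a) - (-1) ^ m * fermiDeriv (m + 1) a)‖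
        ≤ A * ‖h‖ ^ (N + 1) := by
  choose C hC using fun j => exists_fermiDeriv_bound hK j
  obtain ⟨B, hB0, hB⟩ := exists_bernoulliFun_div_factorial_bound (N + 1)
  refine ⟨B * (2 * Real.exp 1 * C (m + (N + 2) - 1)) * (2 * (K + 1)),
    fun h a hre hre1 him ha => ?_⟩
  have H := (fermiChain_eulerMaclaurin hK hC m hre him ha).norm_tsum_add_le N hB
  -- Summing the remainders costs only one power of `h`: `1 - e^(-x) ≥ x/2` on `[0, 1]`, and `‖h‖ ≤
  -- (K + 1) Re h` in the sector.
  have hinv : (1 - Real.exp (-h.re))⁻¹ * ‖h‖ ≤ 2 * (K + 1) := by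
    have h1 : h.re / 2 ≤ 1 - Real.exp (-h.re) := by
      have h4 := Real.add_one_le_exp (h.re)
      have h5 : Real.exp (-h.re) ≤ (1 + h.re)⁻¹ := by
        rw [Real.exp_neg]
        gcongr
        linarith
      have h6 : (1 + h.re)⁻¹ ≤ 1 - h.re / 2 := by
        rw [inv_le_iff_one_le_mul₀ (by linarith)]
        nlinarith
      linarith
    have h2 : ‖h‖ ≤ (K + 1) * h.re := by
      have := Complex.norm_le_abs_re_add_abs_im h
      rw [abs_of_pos hre] at this
      linarith
    rw [inv_mul_le_iff₀ (by linarith)]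
    nlinarith
  have hnorm : h * (∑' k : ℕ, (fermiDeriv (m + 1) ((k + 1 : ℕ) * h - a)
            - (-1) ^ m * fermiDeriv (m + 1) ((k + 1 : ℕ) * h + a)))
          + (fermiDeriv m (-a) - (-1) ^ m * fermiDeriv m a)
          + h / 2 * (fermiDeriv (m + 1) (-a) - (-1) ^ m * fermiDeriv (m + 1) a) =
      (∑' k : ℕ, fermiChain m h a 1 (k + 1)) + fermiChain m h a 0 0 + fermiChain m h a 1 0 / 2 := by
    simp only [fermiChain, pow_one, tsum_mul_left]
    simp
    ring
  rw [hnorm]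
  refine H.trans ?_
  have hCnn := (hC (m + (N + 2) - 1)).1
  calc B * (‖h‖ ^ (N + 2) * (2 * Real.exp 1 * C (m + (N + 2) - 1))) * (1 - Real.exp (-h.re))⁻¹
      = B * (2 * Real.exp 1 * C (m + (N + 2) - 1)) * ((1 - Real.exp (-h.re))⁻¹ * ‖h‖)
          * ‖h‖ ^ (N + 1) := by ring
    _ ≤ _ := by gcongr

/-! ### Exponential form of the boundary series -/

theorem hasSum_succ_pow_mul_geometric {q : ℂ} (hq : ‖q‖ < 1) :
    HasSum (fun n : ℕ => ((n + 1 : ℕ) : ℂ) ^ 0 * q ^ (n + 1)) (q / (1 - q)) ∧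
    HasSum (fun n : ℕ => ((n + 1 : ℕ) : ℂ) ^ 1 * q ^ (n + 1)) (q / (1 - q) ^ 2) ∧
    HasSum (fun n : ℕ => ((n + 1 : ℕ) : ℂ) ^ 2 * q ^ (n + 1)) (q * (1 + q) / (1 - q) ^ 3) := by
  have hne : 1 - q ≠ 0 := by
    intro h
    rw [← sub_eq_zero.1 h] at hq
    simp at hq
  have h0 := (hasSum_geometric_of_norm_lt_one hq).mul_left q
  have h1 := (hasSum_choose_mul_geometric_of_norm_lt_one 1 hq).mul_left q
  -- Squares come from `(n + 1)² = 2 C(n + 2, 2) - (n + 1)`.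
  have h2 := (hasSum_choose_mul_geometric_of_norm_lt_one 2 hq).mul_left (2 * q)
  refine ⟨?_, ?_, ?_⟩
  · convert! h0 using 1
    ext n
    ring
  · convert! h1 using 1
    · ext n
      rw [Nat.choose_one_right]
      push_cast
      ring
    · ring
  · convert! h2.sub h1 using 1
    · ext n
      have h3 : (((n + 2).choose 2 : ℕ) : ℂ) = (n + 2) * (n + 1) / 2 := by
        rw [Nat.cast_choose_two]
        push_cast
        ring
      rw [h3, Nat.choose_one_right]
      push_cast
      ring
    · field_simp
      ring

/-- Formally, differentiate `F(w) = ∑ (-1)^n e^(-nw)` termwise `m` times. For the three orders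
needed, comparing closed forms replaces the differentiation. -/
theorem hasSum_fermiDeriv {m : ℕ} (hm : m ≤ 2) {w : ℂ} (hw : 0 < w.re) :
    HasSum (fun n : ℕ => ((n + 1 : ℕ) : ℂ) ^ m * (-1) ^ (n + 1) *
      Complex.exp (-((n + 1 : ℕ) * w))) ((-1) ^ m * fermiDeriv (m + 1) w) := by
  have hq : ‖-Complex.exp (-w)‖ < 1 := by
    rw [norm_neg, Complex.norm_exp, Complex.neg_re, Real.exp_lt_one_iff]
    linarith
  have hpow : ∀ n : ℕ, (-1 : ℂ) ^ n * Complex.exp (-(n * w)) = (-Complex.exp (-w)) ^ n := by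
    intro n
    rw [neg_pow (Complex.exp (-w)), ← Complex.exp_nat_mul]
    ring_nf
  have hne : 1 - -Complex.exp (-w) ≠ 0 := by
    intro h
    rw [← sub_eq_zero.1 h] at hq
    simp at hq
  have hf : fermi w = -Complex.exp (-w) / (1 - -Complex.exp (-w)) := by
    rw [fermi, exp_add_one_eq, mul_inv, ← Complex.exp_neg, sub_neg_eq_add]
    ring
  obtain ⟨h0, h1, h2⟩ := hasSum_succ_pow_mul_geometric hq
  simp only [mul_assoc, hpow]
  interval_cases m
  · convert! h0 using 1
    simp [fermiDeriv, fermiPoly, hf]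
  · convert! h1 using 1
    simp only [fermiDeriv, fermiPoly, hf, Polynomial.derivative_X, mul_one, Polynomial.eval_neg,
      Polynomial.eval_mul, Polynomial.eval_add, Polynomial.eval_one, Polynomial.eval_X]
    field_simp
    ring
  · convert! h2 using 1
    simp only [fermiDeriv, fermiPoly, hf, Polynomial.derivative_X, mul_one, Polynomial.eval_neg,
      Polynomial.eval_mul, Polynomial.eval_add, Polynomial.eval_one, Polynomial.eval_X,
      Polynomial.derivative_neg, Polynomial.derivative_mul, Polynomial.derivative_add,
      Polynomial.derivative_one, one_mul, zero_add]
    field_simp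
    ring

/-- The term of the series with `e^(-n σ)` in place of a trigonometric function. -/
noncomputable def expTerm (m : ℕ) (h σ : ℂ) (n : ℕ) : ℂ :=
  (n : ℂ) ^ m * (-1) ^ n / (Complex.exp (n * h) - 1) * Complex.exp (-(n * σ))

/-- For `n ≥ 1` and `k ≥ 0`, `n ((k + 1) Re h + Re σ) ≥ n (Re h + Re σ) + k Re h`, so a product of
two convergent series dominates. -/
theorem summable_double {h σ : ℂ} (hσ : |σ.re| < h.re) (m : ℕ) :
    Summable fun p : ℕ × ℕ => ((p.1 + 1 : ℕ) : ℂ) ^ m * (-1) ^ (p.1 + 1) *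
      Complex.exp (-((p.1 + 1 : ℕ) * ((p.2 + 1 : ℕ) * h + σ))) := by
  have hre : 0 < h.re := (abs_nonneg _).trans_lt hσ
  have hs := (abs_lt.1 hσ).1
  have h1 := (summable_nat_add_iff 1).2
    (Real.summable_pow_mul_exp_neg_nat_mul m (r := h.re + σ.re) (by linarith))
  have h2 := Real.summable_pow_mul_exp_neg_nat_mul 0 hre
  refine Summable.of_norm_bounded (h1.mul_of_nonneg h2 (fun _ => by positivity)
    fun _ => by positivity) fun p => ?_
  rw [norm_mul, norm_mul, norm_pow, norm_pow, norm_neg, norm_one, one_pow, mul_one,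
    Complex.norm_natCast, Complex.norm_exp, pow_zero, one_mul, mul_assoc, ← Real.exp_add]
  refine mul_le_mul_of_nonneg_left (Real.exp_le_exp.2 ?_) (by positivity)
  have h3 : 0 ≤ (p.1 : ℝ) * (p.2 * h.re) := by positivity
  simp
  nlinarith

theorem hasSum_expTerm_row {h : ℂ} (hre : 0 < h.re) (σ : ℂ) (m n : ℕ) :
    HasSum (fun k : ℕ => ((n + 1 : ℕ) : ℂ) ^ m * (-1) ^ (n + 1) *
      Complex.exp (-((n + 1 : ℕ) * ((k + 1 : ℕ) * h + σ)))) (expTerm m h σ (n + 1)) := by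
  have hq : ‖Complex.exp (-((n + 1 : ℕ) * h))‖ < 1 := by
    rw [Complex.norm_exp, Real.exp_lt_one_iff, Complex.neg_re, ← Complex.ofReal_natCast,
      Complex.re_ofReal_mul, neg_lt_zero]
    positivity
  have h1 := (hasSum_geometric_of_norm_lt_one hq).mul_left
    (((n + 1 : ℕ) : ℂ) ^ m * (-1) ^ (n + 1) * Complex.exp (-((n + 1 : ℕ) * σ)) *
      Complex.exp (-((n + 1 : ℕ) * h)))
  convert! h1 using 1
  · ext k
    rw [← Complex.exp_nat_mul, mul_assoc _ (Complex.exp (-(((n + 1 : ℕ) : ℂ) * h))),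
      mul_assoc _ (Complex.exp (-(((n + 1 : ℕ) : ℂ) * σ))), ← Complex.exp_add, ← Complex.exp_add]
    congr 2
    push_cast
    ring
  · have hne : Complex.exp ((n + 1 : ℕ) * h) ≠ 0 := Complex.exp_ne_zero _
    have hne1 : Complex.exp ((n + 1 : ℕ) * h) - 1 ≠ 0 := by
      intro h0
      rw [Complex.exp_neg, sub_eq_zero.1 h0] at hq
      simp at hq
    rw [expTerm, Complex.exp_neg (((n + 1 : ℕ) : ℂ) * h)]
    generalize Complex.exp (((n + 1 : ℕ) : ℂ) * h) = y at hne hne1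
    have : 1 - y⁻¹ = (y - 1) / y := by field_simp
    rw [this]
    field_simp

theorem summable_expTerm {h σ : ℂ} (hσ : |σ.re| < h.re) (m : ℕ) :
    Summable fun n : ℕ => expTerm m h σ (n + 1) := by
  have h1 := (summable_double hσ m).prod
  exact h1.congr fun n => (hasSum_expTerm_row ((abs_nonneg _).trans_lt hσ) σ m n).tsum_eq

theorem hasSum_column_of_hasSum_row {G : ℕ → ℕ → ℂ} {u v : ℕ → ℂ}
    (hs : Summable fun p : ℕ × ℕ => G p.1 p.2) (hu : ∀ n, HasSum (fun k => G n k) (u n))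
    (hv : ∀ k, HasSum (fun n => G n k) (v k)) : HasSum v (∑' n, u n) := by
  have h1 : HasSum v (∑' p : ℕ × ℕ, G p.swap.1 p.swap.2) :=
    HasSum.prod_fiberwise (f := fun p : ℕ × ℕ => G p.swap.1 p.swap.2) hs.prod_symm.hasSum hv
  rw [(hs.hasSum.prod_fiberwise hu).tsum_eq]
  rw [← (Equiv.prodComm ℕ ℕ).tsum_eq fun p : ℕ × ℕ => G p.1 p.2]
  exact h1

theorem hasSum_fermiDeriv_column {h σ : ℂ} (hσ : |σ.re| < h.re) {m : ℕ} (hm : m ≤ 2) :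
    HasSum (fun k : ℕ => (-1) ^ m * fermiDeriv (m + 1) ((k + 1 : ℕ) * h + σ))
      (∑' n : ℕ, expTerm m h σ (n + 1)) := by
  have hre : 0 < h.re := (abs_nonneg _).trans_lt hσ
  have hcol : ∀ k : ℕ, 0 < (((k + 1 : ℕ) : ℂ) * h + σ).re := by
    intro k
    have h1 := (abs_lt.1 hσ).1
    rw [Complex.add_re, ← Complex.ofReal_natCast, Complex.re_ofReal_mul]
    push_cast
    nlinarith [mul_nonneg (Nat.cast_nonneg (α := ℝ) k) hre.le]
  exact hasSum_column_of_hasSum_row (summable_double hσ m) (hasSum_expTerm_row hre σ m)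
    fun k => hasSum_fermiDeriv hm (hcol k)

theorem sinTerm_eq (β₀ r : ℝ) (m : ℕ) (κ : ℂ) (n : ℕ) :
    sinTerm β₀ r m κ n = Complex.I / 2 *
      (expTerm m (κ * β₀) (2 * Complex.I * Complex.arctan (κ * r)) n
        - expTerm m (κ * β₀) (-(2 * Complex.I * Complex.arctan (κ * r))) n) := by
  rw [sinTerm, expTerm, expTerm, Complex.sin]
  ring_nf

theorem cosTerm_eq (β₀ r : ℝ) (m : ℕ) (κ : ℂ) (n : ℕ) :
    cosTerm β₀ r m κ n = 1 / 2 *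
      (expTerm m (κ * β₀) (2 * Complex.I * Complex.arctan (κ * r)) n
        + expTerm m (κ * β₀) (-(2 * Complex.I * Complex.arctan (κ * r))) n) := by
  rw [cosTerm, expTerm, expTerm, Complex.cos]
  ring_nf

theorem abs_re_lt_of_mem_kappaDomain {β₀ r : ℝ} {κ : ℂ} (hκ : κ ∈ kappaDomain β₀ r) :
    |(2 * Complex.I * Complex.arctan (κ * r)).re| < (κ * β₀).re ∧
    |(-(2 * Complex.I * Complex.arctan (κ * r))).re| < (κ * β₀).re := by
  have h1 : (2 * Complex.I * Complex.arctan (κ * r)).re = -(2 * (Complex.arctan (κ * r)).im) := by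
    simp
  have h2 : (κ * β₀).re = β₀ * κ.re := by
    rw [mul_comm, Complex.re_ofReal_mul]
  rw [Complex.neg_re, abs_neg, h1, h2, abs_neg, abs_mul, abs_two]
  exact ⟨hκ.2, hκ.2⟩

theorem summable_sinTerm {β₀ r : ℝ} {κ : ℂ} (hκ : κ ∈ kappaDomain β₀ r) (m : ℕ) :
    Summable fun n : ℕ => sinTerm β₀ r m κ (n + 1) := by
  obtain ⟨h1, h2⟩ := abs_re_lt_of_mem_kappaDomain hκ
  simp only [sinTerm_eq]
  exact ((summable_expTerm h1 m).sub (summable_expTerm h2 m)).mul_left _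

theorem summable_cosTerm {β₀ r : ℝ} {κ : ℂ} (hκ : κ ∈ kappaDomain β₀ r) (m : ℕ) :
    Summable fun n : ℕ => cosTerm β₀ r m κ (n + 1) := by
  obtain ⟨h1, h2⟩ := abs_re_lt_of_mem_kappaDomain hκ
  simp only [cosTerm_eq]
  exact ((summable_expTerm h1 m).add (summable_expTerm h2 m)).mul_left _

/-- For even `m` the sine produces the difference of the two shifts that `fermiChain` handles; for
odd `m` the cosine does. -/
theorem seriesS_eq {β₀ r : ℝ} {κ : ℂ} (hκ : κ ∈ kappaDomain β₀ r) {m : ℕ} (hm : m ≤ 2)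
    (heven : Even m) :
    seriesS β₀ r m κ = -(Complex.I / 2) * ∑' k : ℕ,
      (fermiDeriv (m + 1) ((k + 1 : ℕ) * (κ * β₀) - 2 * Complex.I * Complex.arctan (κ * r))
        - (-1) ^ m * fermiDeriv (m + 1)
          ((k + 1 : ℕ) * (κ * β₀) + 2 * Complex.I * Complex.arctan (κ * r))) := by
  obtain ⟨h1, h2⟩ := abs_re_lt_of_mem_kappaDomain hκ
  have h3 := ((hasSum_fermiDeriv_column h2 hm).sub (hasSum_fermiDeriv_column h1 hm)).tsum_eq
  simp only [heven.neg_one_pow, one_mul, ← sub_eq_add_neg] at h3 ⊢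
  rw [h3, seriesS]
  simp only [sinTerm_eq]
  rw [tsum_mul_left, (summable_expTerm h1 m).tsum_sub (summable_expTerm h2 m)]
  ring

theorem seriesC_eq {β₀ r : ℝ} {κ : ℂ} (hκ : κ ∈ kappaDomain β₀ r) {m : ℕ} (hm : m ≤ 2)
    (hodd : Odd m) :
    seriesC β₀ r m κ = -(1 / 2) * ∑' k : ℕ,
      (fermiDeriv (m + 1) ((k + 1 : ℕ) * (κ * β₀) - 2 * Complex.I * Complex.arctan (κ * r))
        - (-1) ^ m * fermiDeriv (m + 1)
          ((k + 1 : ℕ) * (κ * β₀) + 2 * Complex.I * Complex.arctan (κ * r))) := by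
  obtain ⟨h1, h2⟩ := abs_re_lt_of_mem_kappaDomain hκ
  have h3 := ((hasSum_fermiDeriv_column h2 hm).add (hasSum_fermiDeriv_column h1 hm)).tsum_eq
  have h4 : ∀ x y : ℂ, x - (-1) ^ m * y = -((-1) ^ m * x + (-1) ^ m * y) := fun x y => by
    rw [hodd.neg_one_pow]
    ring
  simp only [← sub_eq_add_neg] at h3
  simp only [h4, tsum_neg]
  rw [h3, seriesC]
  simp only [cosTerm_eq]
  rw [tsum_mul_left, (summable_expTerm h1 m).tsum_add (summable_expTerm h2 m)]
  ring

/-! ### Divergence outside the domain -/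

theorem norm_exp_sub_exp_neg_ge (z : ℂ) :
    2 * Real.sinh |z.re| ≤ ‖Complex.exp z - Complex.exp (-z)‖ ∧
    2 * Real.sinh |z.re| ≤ ‖Complex.exp z + Complex.exp (-z)‖ := by
  have h1 : |‖Complex.exp z‖ - ‖Complex.exp (-z)‖| = 2 * Real.sinh |z.re| := by
    rw [Complex.norm_exp, Complex.norm_exp, Complex.neg_re, ← Real.abs_sinh, Real.sinh_eq, abs_div,
      abs_two]
    ring
  rw [← h1]
  refine ⟨abs_norm_sub_norm_le _ _, ?_⟩
  have h2 := abs_norm_sub_norm_le (Complex.exp z) (-Complex.exp (-z))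
  rwa [norm_neg, sub_neg_eq_add] at h2

/-- With `b = β₀ Re κ ≤ 2 |Im arctan (κ r)|`, the trigonometric factor is at least `sinh (n b)`
while the denominator is at most `e^(n b) + 1`, so the terms stay away from `0`. -/
theorem mem_kappaDomain_of_tendsto {β₀ r : ℝ} (hβ₀ : 0 < β₀) {κ : ℂ} (hκ : 0 < κ.re) {m : ℕ}
    {T : ℕ → ℂ} (hT : Tendsto T atTop (𝓝 0))
    (hle : ∀ n : ℕ, ‖((n + 1 : ℕ) : ℂ) ^ m * (-1) ^ (n + 1) /
        (Complex.exp ((n + 1 : ℕ) * κ * β₀) - 1)‖ *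
      Real.sinh |(n + 1 : ℕ) * (2 * (Complex.arctan (κ * r)).im)| ≤ ‖T n‖) :
    κ ∈ kappaDomain β₀ r := by
  by_contra hmem
  have hge : β₀ * κ.re ≤ 2 * |(Complex.arctan (κ * r)).im| := by
    by_contra! h
    exact hmem ⟨hκ, h⟩
  set b := β₀ * κ.re with hb
  have hb0 : 0 < b := mul_pos hβ₀ hκ
  have hlow : ∀ n : ℕ, Real.sinh b / (Real.exp b + 1) ≤ ‖T n‖ := by
    intro n
    refine le_trans ?_ (hle n)
    set x : ℝ := (n + 1 : ℕ) * b with hx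
    have hbx : b ≤ x := by
      rw [hx]
      push_cast
      nlinarith [mul_nonneg (Nat.cast_nonneg (α := ℝ) n) hb0.le]
    have h1 : x ≤ |(n + 1 : ℕ) * (2 * (Complex.arctan (κ * r)).im)| := by
      rw [abs_mul, abs_mul, abs_two, Nat.abs_cast]
      exact mul_le_mul_of_nonneg_left hge (Nat.cast_nonneg _)
    have h2 : ‖Complex.exp ((n + 1 : ℕ) * κ * β₀) - 1‖ ≤ Real.exp x + 1 := by
      refine (norm_sub_le _ _).trans ?_
      rw [Complex.norm_exp, norm_one]
      have : (((n + 1 : ℕ) : ℂ) * κ * β₀).re = x := by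
        rw [hx, hb, mul_assoc, ← Complex.ofReal_natCast, Complex.re_ofReal_mul, mul_comm κ,
          Complex.re_ofReal_mul]
      rw [this]
    have h2' : 0 < ‖Complex.exp ((n + 1 : ℕ) * κ * β₀) - 1‖ := by
      rw [norm_pos_iff, sub_ne_zero]
      intro h0
      have h3 := congrArg norm h0
      rw [Complex.norm_exp, norm_one, Real.exp_eq_one_iff] at h3
      rw [mul_assoc, ← Complex.ofReal_natCast, Complex.re_ofReal_mul, mul_comm κ,
          Complex.re_ofReal_mul] at h3
      have : 0 < ((n + 1 : ℕ) : ℝ) * b := by positivity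
      linarith
    have h3 : (1 : ℝ) ≤ ((n + 1 : ℕ) : ℝ) ^ m := one_le_pow₀ (by simp)
    rw [norm_div, norm_mul, norm_pow, norm_pow, norm_neg, norm_one, one_pow, mul_one,
      Complex.norm_natCast]
    have h4 : Real.sinh x ≤ Real.sinh |(n + 1 : ℕ) * (2 * (Complex.arctan (κ * r)).im)| :=
      Real.sinh_le_sinh.2 h1
    have h5 : 0 < Real.sinh x := Real.sinh_pos_iff.2 (by linarith)
    -- The quotient equals `(1 - e^(-x))/2`, which increases with `x`.
    calc Real.sinh b / (Real.exp b + 1) ≤ Real.sinh x / (Real.exp x + 1) := by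
          rw [div_le_div_iff₀ (by positivity) (by positivity)]
          have h6 := Real.exp_le_exp.2 hbx
          have h7 : Real.exp (-x) ≤ Real.exp (-b) := Real.exp_le_exp.2 (by linarith)
          have h8 : Real.exp x * Real.exp (-x) = 1 := by rw [← Real.exp_add]; simp
          have h9 : Real.exp b * Real.exp (-b) = 1 := by rw [← Real.exp_add]; simp
          rw [Real.sinh_eq, Real.sinh_eq]
          nlinarith [Real.exp_pos x, Real.exp_pos b, Real.exp_pos (-x), Real.exp_pos (-b),
            mul_le_mul h6 h7 (Real.exp_pos _).le (Real.exp_pos _).le]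
      _ ≤ 1 / (Real.exp x + 1) * Real.sinh x := by
          rw [one_div_mul_eq_div]
      _ ≤ _ := by gcongr
  have h1 := ge_of_tendsto' (tendsto_zero_iff_norm_tendsto_zero.1 hT) hlow
  have h2 : 0 < Real.sinh b / (Real.exp b + 1) :=
    div_pos (Real.sinh_pos_iff.2 hb0) (by positivity)
  linarith

theorem summable_iff_mem_kappaDomain {β₀ r : ℝ} (hβ₀ : 0 < β₀) {κ : ℂ} (hκ : 0 < κ.re) (m : ℕ) :
    ((Summable fun n : ℕ => sinTerm β₀ r m κ (n + 1)) ↔ κ ∈ kappaDomain β₀ r) ∧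
    ((Summable fun n : ℕ => cosTerm β₀ r m κ (n + 1)) ↔ κ ∈ kappaDomain β₀ r) := by
  have hz : ∀ n : ℕ, |(2 * (n : ℂ) * Complex.arctan (κ * r) * Complex.I).re| =
      |n * (2 * (Complex.arctan (κ * r)).im)| := by
    intro n
    rw [Complex.mul_I_re, abs_neg]
    simp
    ring_nf
  refine ⟨⟨fun h => ?_, fun h => summable_sinTerm h m⟩,
    ⟨fun h => ?_, fun h => summable_cosTerm h m⟩⟩
  · refine mem_kappaDomain_of_tendsto (m := m) hβ₀ hκ h.tendsto_atTop_zero fun n => ?_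
    rw [sinTerm, norm_mul]
    refine mul_le_mul_of_nonneg_left ?_ (norm_nonneg _)
    have h1 := (norm_exp_sub_exp_neg_ge
      (2 * ((n + 1 : ℕ) : ℂ) * Complex.arctan (κ * r) * Complex.I)).1
    rw [hz, norm_sub_rev] at h1
    rw [Complex.sin, norm_div, norm_mul, Complex.norm_I, mul_one, Complex.norm_two, neg_mul]
    linarith
  · refine mem_kappaDomain_of_tendsto (m := m) hβ₀ hκ h.tendsto_atTop_zero fun n => ?_
    rw [cosTerm, norm_mul]
    refine mul_le_mul_of_nonneg_left ?_ (norm_nonneg _)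
    have h1 := (norm_exp_sub_exp_neg_ge
      (2 * ((n + 1 : ℕ) : ℂ) * Complex.arctan (κ * r) * Complex.I)).2
    rw [hz] at h1
    rw [Complex.cos, norm_div, Complex.norm_two, neg_mul]
    linarith

/-! ### Asymptotic expansions of the boundary series -/

theorem one_add_mul_I_ne_zero {q : ℂ} (hq : 0 < q.re) :
    1 + q * Complex.I ≠ 0 ∧ 1 - q * Complex.I ≠ 0 := by
  constructor
  · intro h
    have := congrArg Complex.im h
    simp at this
    linarith
  · intro h
    have := congrArg Complex.im h
    simp at this
    linarith

theorem re_mul_ofReal_pos {κ : ℂ} (hκ : 0 < κ.re) {r : ℝ} (hr : 0 < r) : 0 < (κ * r).re := by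
  rw [mul_comm, Complex.re_ofReal_mul]
  exact mul_pos hr hκ

theorem exp_two_I_arctan {q : ℂ} (hq : 0 < q.re) :
    Complex.exp (2 * Complex.I * Complex.arctan q) = (1 + q * Complex.I) / (1 - q * Complex.I) := by
  obtain ⟨h1, h2⟩ := one_add_mul_I_ne_zero hq
  rw [Complex.arctan, ← mul_assoc, show 2 * Complex.I * (-Complex.I / 2) = 1 by
    linear_combination -Complex.I_mul_I, one_mul, Complex.exp_log (div_ne_zero h1 h2)]

theorem fermi_two_I_arctan {q : ℂ} (hq : 0 < q.re) :
    fermi (2 * Complex.I * Complex.arctan q) = -(1 - q * Complex.I) / 2 ∧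
    fermi (-(2 * Complex.I * Complex.arctan q)) = -(1 + q * Complex.I) / 2 := by
  obtain ⟨h1, h2⟩ := one_add_mul_I_ne_zero hq
  have h3 : (1 + q * Complex.I) / (1 - q * Complex.I) + 1 = 2 / (1 - q * Complex.I) := by
    field_simp
    ring
  have h4 : fermi (2 * Complex.I * Complex.arctan q) = -(1 - q * Complex.I) / 2 := by
    rw [fermi, exp_two_I_arctan hq, h3]
    field_simp
  refine ⟨h4, ?_⟩
  rw [fermi_neg, h4]
  · ring
  · rw [exp_two_I_arctan hq, h3]
    exact div_ne_zero two_ne_zero h2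

/-- Both sides have the same exponential. Each logarithm has imaginary part below `π/2` in modulus,
so no multiple of `2πi` intervenes. -/
theorem fermiDeriv_zero_sub {w : ℂ} (h1 : 0 < (1 + Complex.exp w).re)
    (h2 : 0 < (1 + Complex.exp (-w)).re) (hw : |w.im| < Real.pi) :
    fermiDeriv 0 (-w) - fermiDeriv 0 w = w := by
  simp only [fermiDeriv, neg_neg]
  have hne1 : 1 + Complex.exp w ≠ 0 := fun h => by simp [h] at h1
  have hne2 : 1 + Complex.exp (-w) ≠ 0 := fun h => by simp [h] at h2
  have ha1 := abs_lt.1 (Complex.abs_arg_lt_pi_div_two_iff.2 (Or.inl h1))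
  have ha2 := abs_lt.1 (Complex.abs_arg_lt_pi_div_two_iff.2 (Or.inl h2))
  have him := abs_lt.1 hw
  have h3 : Complex.exp (Complex.log (1 + Complex.exp w) - Complex.log (1 + Complex.exp (-w))) =
      Complex.exp w := by
    rw [Complex.exp_sub, Complex.exp_log hne1, Complex.exp_log hne2, div_eq_iff hne2, mul_add,
      ← Complex.exp_add]
    simp
    ring
  have h4 := congrArg Complex.log h3
  rwa [Complex.log_exp _ _, Complex.log_exp him.1 him.2.le] at h4
  · rw [Complex.sub_im, Complex.log_im, Complex.log_im]
    linarith
  · rw [Complex.sub_im, Complex.log_im, Complex.log_im]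
    linarith

theorem hasDerivAt_arctan_zero : HasDerivAt Complex.arctan 1 0 := by
  have h1 : HasDerivAt (fun z : ℂ => 1 + z * Complex.I) Complex.I 0 := by
    simpa using ((hasDerivAt_id (0 : ℂ)).mul_const Complex.I).const_add 1
  have h2 : HasDerivAt (fun z : ℂ => 1 - z * Complex.I) (-Complex.I) 0 := by
    simpa using ((hasDerivAt_id (0 : ℂ)).mul_const Complex.I).const_sub 1
  have h3 := ((h1.div h2 (by simp)).clog (by simp)).const_mul (-Complex.I / 2)
  convert! h3 using 1
  simp
  linear_combination Complex.I_mul_I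

theorem norm_arctan_sub_self_le : ∀ᶠ z : ℂ in 𝓝 0, ‖Complex.arctan z - z‖ ≤ 1 / 2 * ‖z‖ := by
  have h := hasDerivAt_arctan_zero.isLittleO.def (c := 1 / 2) (by norm_num)
  simpa [Complex.arctan] using h

/-- Near `0`, `arctan (κ r)` differs from `κ r` by at most `‖κ r‖/2`. The inequality defining `D`
then gives `r |Im κ| ≤ β₀ Re κ/2 + r (Re κ + |Im κ|)/2`, hence the slope `β₀/r + 1`. -/
theorem eventually_kappaDomain_sector {β₀ r : ℝ} (hβ₀ : 0 < β₀) (hr : 0 < r) :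
    ∀ᶠ κ in 𝓝[kappaDomain β₀ r] 0, κ ∈ kappaDomain β₀ r ∧ 0 < (κ * β₀).re ∧ (κ * β₀).re ≤ 1 ∧
      |(κ * β₀).im| ≤ (β₀ / r + 1) * (κ * β₀).re ∧
      (β₀ / r + 1 + 1) * ‖2 * Complex.I * Complex.arctan (κ * r)‖ ≤ 1 := by
  have hcr : Tendsto (fun κ : ℂ => κ * r) (𝓝[kappaDomain β₀ r] 0) (𝓝 0) := by
    have : Continuous fun κ : ℂ => κ * r := by fun_prop
    simpa using (this.tendsto 0).mono_left nhdsWithin_le_nhds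
  have hcβ : Tendsto (fun κ : ℂ => (κ * β₀).re) (𝓝[kappaDomain β₀ r] 0) (𝓝 0) := by
    have : Continuous fun κ : ℂ => (κ * β₀).re := by fun_prop
    simpa using (this.tendsto 0).mono_left nhdsWithin_le_nhds
  have hat : Tendsto (fun κ : ℂ => (β₀ / r + 1 + 1) * ‖2 * Complex.I * Complex.arctan (κ * r)‖)
      (𝓝[kappaDomain β₀ r] 0) (𝓝 0) := by
    have h1 := (hasDerivAt_arctan_zero.continuousAt.tendsto.comp hcr)
    have h2 := ((h1.const_mul (2 * Complex.I)).norm.const_mul (β₀ / r + 1 + 1))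
    simpa [Complex.arctan] using h2
  filter_upwards [self_mem_nhdsWithin, hcr.eventually norm_arctan_sub_self_le,
    hcβ.eventually_le_const one_pos, hat.eventually_le_const one_pos] with κ hκ h1 h2 h3
  have hβre : (κ * β₀).re = β₀ * κ.re := by rw [mul_comm, Complex.re_ofReal_mul]
  have hβim : (κ * β₀).im = β₀ * κ.im := by rw [mul_comm, Complex.im_ofReal_mul]
  refine ⟨hκ, ?_, h2, ?_, h3⟩
  · rw [hβre]
    exact mul_pos hβ₀ hκ.1
  · have h4 : |(κ * r).im| ≤ |(Complex.arctan (κ * r)).im| + ‖Complex.arctan (κ * r) - κ * r‖ := by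
      have h5 := Complex.abs_im_le_norm (Complex.arctan (κ * r) - κ * r)
      rw [Complex.sub_im] at h5
      have h6 := abs_sub_abs_le_abs_sub (κ * r).im (Complex.arctan (κ * r)).im
      rw [abs_sub_comm] at h6
      linarith
    have h5 := Complex.norm_le_abs_re_add_abs_im (κ * r)
    have hrre : (κ * r).re = r * κ.re := by rw [mul_comm, Complex.re_ofReal_mul]
    have hrim : (κ * r).im = r * κ.im := by rw [mul_comm, Complex.im_ofReal_mul]
    rw [hrre, hrim, abs_mul, abs_mul, abs_of_pos hr, abs_of_pos hκ.1] at h5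
    rw [hrim, abs_mul, abs_of_pos hr] at h4
    have h6 := hκ.2
    have h7 : |κ.im| ≤ (β₀ / r + 1) * κ.re := by
      have h8 : r * |κ.im| ≤ β₀ * κ.re + r * κ.re := by linarith
      have h9 : (β₀ / r + 1) * κ.re = (β₀ * κ.re + r * κ.re) / r := by field_simp
      rw [h9, le_div_iff₀ hr]
      linarith
    rw [hβre, hβim, abs_mul, abs_of_pos hβ₀]
    nlinarith

/-- The sum over `k` in the resummed boundary series. -/
noncomputable def fermiSum (β₀ r : ℝ) (m : ℕ) (κ : ℂ) : ℂ :=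
  ∑' k : ℕ, (fermiDeriv (m + 1) ((k + 1 : ℕ) * (κ * β₀) - 2 * Complex.I * Complex.arctan (κ * r))
    - (-1) ^ m * fermiDeriv (m + 1)
      ((k + 1 : ℕ) * (κ * β₀) + 2 * Complex.I * Complex.arctan (κ * r)))

/-- The `m`-th derivative of the Fermi function antisymmetrised or symmetrised at `arctan (κ r)`. -/
noncomputable def fermiJump (m l : ℕ) (q : ℂ) : ℂ :=
  fermiDeriv l (-(2 * Complex.I * Complex.arctan q))
    - (-1) ^ m * fermiDeriv l (2 * Complex.I * Complex.arctan q)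

theorem fermiSum_isBigO {β₀ r : ℝ} (hβ₀ : 0 < β₀) (hr : 0 < r) (m N : ℕ) :
    (fun κ => fermiSum β₀ r m κ + fermiJump m m (κ * r) / (κ * β₀)
      + fermiJump m (m + 1) (κ * r) / 2) =O[𝓝[kappaDomain β₀ r] 0] fun κ => κ ^ N := by
  obtain ⟨A, hA⟩ := fermi_sum_expansion (K := β₀ / r + 1) (by positivity) m N
  refine IsBigO.of_bound (A * β₀ ^ N) ?_
  filter_upwards [eventually_kappaDomain_sector hβ₀ hr] with κ hκ
  obtain ⟨-, h0, h1, h2, h3⟩ := hκ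
  have h4 := hA _ _ h0 h1 h2 h3
  have hne : κ * β₀ ≠ 0 := fun h => by simp [h] at h0
  have hpos : 0 < ‖κ * β₀‖ := norm_pos_iff.2 hne
  rw [← fermiSum, ← fermiJump, ← fermiJump] at h4
  have h5 : κ * β₀ * fermiSum β₀ r m κ + fermiJump m m (κ * r)
      + κ * β₀ / 2 * fermiJump m (m + 1) (κ * r) =
      κ * β₀ * (fermiSum β₀ r m κ + fermiJump m m (κ * r) / (κ * β₀)
      + fermiJump m (m + 1) (κ * r) / 2) := by
    rw [mul_add, mul_add, mul_div_cancel₀ _ hne]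
    ring
  rw [h5, norm_mul, pow_succ, ← mul_assoc, mul_comm ‖κ * β₀‖] at h4
  have h6 := le_of_mul_le_mul_right h4 hpos
  rw [norm_mul, mul_pow, Complex.norm_real, Real.norm_of_nonneg hβ₀.le] at h6
  rw [norm_pow]
  linarith

theorem seriesS_zero_asymptotic {β₀ r : ℝ} (hβ₀ : 0 < β₀) (hr : 0 < r) :
    AsymptoticEq (kappaDomain β₀ r) (seriesS β₀ r 0)
      (fun κ => -(Complex.arctan (r * κ) / (β₀ * κ)) + r * κ / 4) := by
  intro N
  refine ((fermiSum_isBigO hβ₀ hr 0 N).const_mul_left (-(Complex.I / 2))).congr' ?_ .rfl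
  obtain ⟨c, hc, hcw⟩ := exists_le_re_one_add_exp_neg (K := β₀ / r + 1) (by positivity)
  filter_upwards [eventually_kappaDomain_sector hβ₀ hr] with κ hκ
  obtain ⟨hD, -, -, h2, h3⟩ := hκ
  rw [seriesS_eq hD (by norm_num) (by decide), ← fermiSum, mul_comm (r : ℂ) κ]
  obtain ⟨hf1, hf2⟩ := fermi_two_I_arctan (re_mul_ofReal_pos hD.1 hr)
  have hJ0 : fermiJump 0 0 (κ * r) = 2 * Complex.I * Complex.arctan (κ * r) := by
    have hm1 := hcw _ (mem_fermiRegion (by positivity) h2 h3 (x := 0) le_rfl)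
    have hm2 := hcw _ (mem_fermiRegion (a := -(2 * Complex.I * Complex.arctan (κ * r)))
      (by positivity) h2 (by rwa [norm_neg]) (x := 0) le_rfl)
    simp only [Complex.ofReal_zero, zero_mul, zero_add, neg_neg] at hm1 hm2
    rw [fermiJump, pow_zero, one_mul]
    refine fermiDeriv_zero_sub (hc.trans_le hm2) (hc.trans_le hm1) ?_
    have h4 := Complex.abs_im_le_norm (2 * Complex.I * Complex.arctan (κ * r))
    have h5 : 0 < β₀ / r := by positivity
    have h6 := Real.pi_gt_three
    nlinarith [norm_nonneg (2 * Complex.I * Complex.arctan (κ * r))]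
  have hJ1 : fermiJump 0 1 (κ * r) = -(κ * r * Complex.I) := by
    simp only [fermiJump, fermiDeriv, fermiPoly, Polynomial.eval_X, hf1, hf2]
    ring
  rw [hJ0, hJ1, mul_comm (β₀ : ℂ) κ]
  linear_combination (-(Complex.arctan (κ * r) / (κ * β₀)) + κ * r / 4) * Complex.I_mul_I

theorem seriesC_one_asymptotic {β₀ r : ℝ} (hβ₀ : 0 < β₀) (hr : 0 < r) :
    AsymptoticEq (kappaDomain β₀ r) (seriesC β₀ r 1)
      (fun κ => -(1 / (2 * β₀ * κ)) + 1 / 8 + (r * κ) ^ 2 / 8) := by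
  intro N
  refine ((fermiSum_isBigO hβ₀ hr 1 N).const_mul_left (-(1 / 2))).congr' ?_ .rfl
  filter_upwards [eventually_kappaDomain_sector hβ₀ hr] with κ hκ
  obtain ⟨hD, h0, -⟩ := hκ
  rw [seriesC_eq hD (by norm_num) (by decide), ← fermiSum, mul_comm (r : ℂ) κ]
  have hne : κ * β₀ ≠ 0 := fun h => by simp [h] at h0
  obtain ⟨hf1, hf2⟩ := fermi_two_I_arctan (re_mul_ofReal_pos hD.1 hr)
  have hJ0 : fermiJump 1 1 (κ * r) = -1 := by
    simp only [fermiJump, fermiDeriv, fermiPoly, Polynomial.eval_X, hf1, hf2]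
    ring
  have hJ1 : fermiJump 1 2 (κ * r) = (1 + (κ * r) ^ 2) / 2 := by
    simp only [fermiJump, fermiDeriv, fermiPoly, Polynomial.derivative_X, mul_one,
      Polynomial.eval_neg, Polynomial.eval_mul, Polynomial.eval_add, Polynomial.eval_one,
      Polynomial.eval_X, hf1, hf2]
    linear_combination (-(κ * r) ^ 2 / 2) * Complex.I_mul_I
  rw [hJ0, hJ1]
  have hκ0 : κ ≠ 0 := left_ne_zero_of_mul hne
  have hβ0 : (β₀ : ℂ) ≠ 0 := right_ne_zero_of_mul hne
  field_simp
  ring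

theorem seriesS_two_asymptotic {β₀ r : ℝ} (hβ₀ : 0 < β₀) (hr : 0 < r) :
    AsymptoticEq (kappaDomain β₀ r) (seriesS β₀ r 2)
      (fun κ => -(r * κ / 8) - (r * κ) ^ 3 / 8) := by
  intro N
  refine ((fermiSum_isBigO hβ₀ hr 2 N).const_mul_left (-(Complex.I / 2))).congr' ?_ .rfl
  filter_upwards [eventually_kappaDomain_sector hβ₀ hr] with κ hκ
  obtain ⟨hD, h0, -⟩ := hκ
  rw [seriesS_eq hD (by norm_num) (by decide), ← fermiSum, mul_comm (r : ℂ) κ]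
  obtain ⟨hf1, hf2⟩ := fermi_two_I_arctan (re_mul_ofReal_pos hD.1 hr)
  have hJ0 : fermiJump 2 2 (κ * r) = 0 := by
    simp only [fermiJump, fermiDeriv, fermiPoly, Polynomial.derivative_X, mul_one,
      Polynomial.eval_neg, Polynomial.eval_mul, Polynomial.eval_add, Polynomial.eval_one,
      Polynomial.eval_X, hf1, hf2]
    ring
  have hJ1 : fermiJump 2 3 (κ * r) = Complex.I * (κ * r) * (1 + (κ * r) ^ 2) / 2 := by
    simp only [fermiJump, fermiDeriv, fermiPoly, Polynomial.derivative_X, mul_one,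
      Polynomial.eval_neg, Polynomial.eval_mul, Polynomial.eval_add, Polynomial.eval_one,
      Polynomial.eval_X, Polynomial.derivative_neg, Polynomial.derivative_mul,
      Polynomial.derivative_add, Polynomial.derivative_one, one_mul, zero_add, hf1, hf2]
    linear_combination (-(κ * r) ^ 3 * Complex.I / 2) * Complex.I_mul_I
  rw [hJ0, hJ1]
  linear_combination (-(κ * r) / 8 * (1 + (κ * r) ^ 2)) * Complex.I_mul_I

/-! ### The domain of the boundary series -/

/-- Only the modulus of `(1 + iq)/(1 - iq)` matters. The right side is visibly continuous and makes
monotonicity in `Re q` accessible. -/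
theorem two_mul_abs_im_arctan {q : ℂ} (hq : 0 < q.re) :
    2 * |(Complex.arctan q).im| =
      |Real.log (q.re ^ 2 + (1 - q.im) ^ 2) - Real.log (q.re ^ 2 + (1 + q.im) ^ 2)| / 2 := by
  obtain ⟨h1, h2⟩ := one_add_mul_I_ne_zero hq
  have him : (Complex.arctan q).im =
      -(Real.log ‖1 + q * Complex.I‖ - Real.log ‖1 - q * Complex.I‖) / 2 := by
    rw [← Real.log_div (norm_ne_zero_iff.2 h1) (norm_ne_zero_iff.2 h2), ← norm_div,
      ← Complex.log_re, Complex.arctan]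
    generalize Complex.log ((1 + q * Complex.I) / (1 - q * Complex.I)) = w
    rw [show -Complex.I / 2 * w = ((-1 / 2 : ℝ) : ℂ) * (Complex.I * w) by push_cast; ring,
      Complex.im_ofReal_mul, Complex.I_mul_im]
    ring
  have e1 : Real.log (q.re ^ 2 + (1 - q.im) ^ 2) = 2 * Real.log ‖1 + q * Complex.I‖ := by
    have h : q.re ^ 2 + (1 - q.im) ^ 2 = ‖1 + q * Complex.I‖ ^ 2 := by
      rw [← Complex.normSq_eq_norm_sq, Complex.normSq_apply]
      simp
      ring
    rw [h, Real.log_pow]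
    norm_num
  have e2 : Real.log (q.re ^ 2 + (1 + q.im) ^ 2) = 2 * Real.log ‖1 - q * Complex.I‖ := by
    have h : q.re ^ 2 + (1 + q.im) ^ 2 = ‖1 - q * Complex.I‖ ^ 2 := by
      rw [← Complex.normSq_eq_norm_sq, Complex.normSq_apply]
      simp
      ring
    rw [h, Real.log_pow]
    norm_num
  rw [him, e1, e2, ← mul_sub, abs_mul, abs_div, abs_neg, abs_two]
  ring

theorem abs_log_add_sub_log_add_le {p s δ : ℝ} (hp : 0 < p) (hs : 0 < s) (hδ : 0 ≤ δ) :
    |Real.log (p + δ) - Real.log (s + δ)| ≤ |Real.log p - Real.log s| := by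
  wlog h : p ≤ s generalizing p s
  · rw [abs_sub_comm, abs_sub_comm (Real.log p)]
    exact this hs hp (le_of_not_ge h)
  have h1 : Real.log p ≤ Real.log s := Real.log_le_log hp h
  have h2 : Real.log (p + δ) ≤ Real.log (s + δ) := Real.log_le_log (by linarith) (by linarith)
  rw [abs_of_nonpos (by linarith), abs_of_nonpos (by linarith)]
  have h3 : Real.log ((s + δ) * p) ≤ Real.log (s * (p + δ)) :=
    Real.log_le_log (by positivity) (by nlinarith)
  rw [Real.log_mul (by positivity) hp.ne', Real.log_mul hs.ne' (by positivity)] at h3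
  linarith

/-- Moving right adds the same amount `2 t Re q + t²` to `|1 + iq|²` and `|1 - iq|²`, which brings
their ratio closer to `1`. -/
theorem two_mul_abs_im_arctan_add_le {q : ℂ} (hq : 0 < q.re) {t : ℝ} (ht : 0 ≤ t) :
    2 * |(Complex.arctan (q + t)).im| ≤ 2 * |(Complex.arctan q).im| := by
  have hq' : 0 < (q + t).re := by
    rw [Complex.add_re, Complex.ofReal_re]
    linarith
  rw [two_mul_abs_im_arctan hq, two_mul_abs_im_arctan hq']
  have h := abs_log_add_sub_log_add_le (p := q.re ^ 2 + (1 - q.im) ^ 2)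
    (s := q.re ^ 2 + (1 + q.im) ^ 2) (δ := 2 * q.re * t + t ^ 2) (by positivity) (by positivity)
    (by positivity)
  simp only [Complex.add_re, Complex.ofReal_re, Complex.add_im, Complex.ofReal_im, add_zero]
  rw [show (q.re + t) ^ 2 + (1 - q.im) ^ 2 = q.re ^ 2 + (1 - q.im) ^ 2 + (2 * q.re * t + t ^ 2) by
    ring, show (q.re + t) ^ 2 + (1 + q.im) ^ 2 =
    q.re ^ 2 + (1 + q.im) ^ 2 + (2 * q.re * t + t ^ 2) by ring]
  linarith

theorem log_sub_log_le {p s : ℝ} (hp : 0 < p) (hs : 0 < s) {C : ℝ} (h : s - p ≤ C * p) :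
    Real.log s - Real.log p ≤ C := by
  rw [← Real.log_div hs.ne' hp.ne']
  have h1 := Real.log_le_sub_one_of_pos (div_pos hs hp)
  have h2 : s / p - 1 ≤ C := by
    rw [sub_le_iff_le_add, div_le_iff₀ hp]
    linarith
  linarith

theorem two_mul_abs_im_arctan_le {q : ℂ} (hq : 1 ≤ q.re) : 2 * |(Complex.arctan q).im| ≤ 4 := by
  rw [two_mul_abs_im_arctan (by linarith)]
  have h1 := log_sub_log_le (p := q.re ^ 2 + (1 - q.im) ^ 2) (s := q.re ^ 2 + (1 + q.im) ^ 2)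
    (C := 8) (by positivity) (by positivity) (by nlinarith [sq_nonneg (4 * q.im - 5)])
  have h2 := log_sub_log_le (s := q.re ^ 2 + (1 - q.im) ^ 2) (p := q.re ^ 2 + (1 + q.im) ^ 2)
    (C := 8) (by positivity) (by positivity) (by nlinarith [sq_nonneg (4 * q.im + 5)])
  have h3 := abs_le.2 ⟨by linarith, h2⟩
  linarith

theorem ofReal_mem_kappaDomain {β₀ r : ℝ} (hβ₀ : 0 < β₀) {κ : ℝ} (hκ : 0 < κ) :
    (κ : ℂ) ∈ kappaDomain β₀ r := by
  refine ⟨by simpa using hκ, ?_⟩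
  rw [← Complex.ofReal_mul, ← Complex.ofReal_arctan, Complex.ofReal_im, Complex.ofReal_re]
  simp only [abs_zero, mul_zero]
  exact mul_pos hβ₀ hκ

theorem isOpen_kappaDomain (β₀ : ℝ) {r : ℝ} (hr : 0 < r) : IsOpen (kappaDomain β₀ r) := by
  have hset : kappaDomain β₀ r = {κ | 0 < κ.re} ∩ (fun κ : ℂ => β₀ * κ.re -
      |Real.log ((κ * r).re ^ 2 + (1 - (κ * r).im) ^ 2)
        - Real.log ((κ * r).re ^ 2 + (1 + (κ * r).im) ^ 2)| / 2) ⁻¹' Set.Ioi 0 := by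
    ext κ
    refine and_congr_right fun h => ?_
    rw [two_mul_abs_im_arctan (re_mul_ofReal_pos h hr), Set.mem_preimage, Set.mem_Ioi, sub_pos]
  rw [hset]
  refine ContinuousOn.isOpen_inter_preimage ?_ (isOpen_lt continuous_const Complex.continuous_re)
    isOpen_Ioi
  have hpos : ∀ κ ∈ {κ : ℂ | 0 < κ.re}, 0 < (κ * r).re ^ 2 := fun κ hκ =>
    pow_pos (re_mul_ofReal_pos hκ hr) 2
  have h1 : ContinuousOn (fun κ : ℂ => Real.log ((κ * r).re ^ 2 + (1 - (κ * r).im) ^ 2))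
      {κ | 0 < κ.re} := by
    refine ContinuousOn.log (Continuous.continuousOn (by fun_prop)) fun κ hκ => ?_
    have := hpos κ hκ
    positivity
  have h2 : ContinuousOn (fun κ : ℂ => Real.log ((κ * r).re ^ 2 + (1 + (κ * r).im) ^ 2))
      {κ | 0 < κ.re} := by
    refine ContinuousOn.log (Continuous.continuousOn (by fun_prop)) fun κ hκ => ?_
    have := hpos κ hκ
    positivity
  exact (Continuous.continuousOn (by fun_prop)).sub ((h1.sub h2).abs.div_const 2)

theorem add_ofReal_mem_kappaDomain {β₀ r : ℝ} (hβ₀ : 0 < β₀) (hr : 0 < r) {κ : ℂ}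
    (hκ : κ ∈ kappaDomain β₀ r) {t : ℝ} (ht : 0 ≤ t) : κ + t ∈ kappaDomain β₀ r := by
  have h1 := two_mul_abs_im_arctan_add_le (re_mul_ofReal_pos hκ.1 hr) (mul_nonneg ht hr.le)
  have h2 := hκ.1
  have h3 := hκ.2
  refine ⟨?_, ?_⟩
  · rw [Complex.add_re, Complex.ofReal_re]
    linarith
  · rw [add_mul, ← Complex.ofReal_mul, Complex.add_re, Complex.ofReal_re]
    nlinarith [mul_nonneg hβ₀.le ht]

theorem mem_kappaDomain_of_le_re {β₀ r : ℝ} (hβ₀ : 0 < β₀) (hr : 0 < r) {κ : ℂ}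
    (hκ : 1 / r + 4 / β₀ ≤ κ.re) : κ ∈ kappaDomain β₀ r := by
  have h1 : 0 < 1 / r := by positivity
  have h2 : 0 < 4 / β₀ := by positivity
  refine ⟨by linarith, (two_mul_abs_im_arctan_le ?_).trans_lt ?_⟩
  · rw [mul_comm, Complex.re_ofReal_mul, ← div_le_iff₀' hr]
    linarith
  · rw [← div_lt_iff₀' hβ₀]
    linarith

/-- The horizontal ray to the right of any point of `D` stays in `D` and reaches a half-plane
contained in `D`. -/
theorem isConnected_kappaDomain {β₀ r : ℝ} (hβ₀ : 0 < β₀) (hr : 0 < r) :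
    IsConnected (kappaDomain β₀ r) := by
  set R : ℝ := 1 / r + 4 / β₀ with hR
  refine ⟨⟨((1 : ℝ) : ℂ), ofReal_mem_kappaDomain hβ₀ one_pos⟩,
    isPreconnected_of_forall (R : ℂ) fun κ hκ => ?_⟩
  have h1 : IsPreconnected ((fun t : ℝ => κ + t) '' Set.Ici 0) :=
    isPreconnected_Ici.image _ (by fun_prop)
  have h2 : IsPreconnected {w : ℂ | R ≤ w.re} := (convex_halfSpace_re_ge R).isPreconnected
  have hR0 : 0 < R := by positivity
  refine ⟨(fun t : ℝ => κ + t) '' Set.Ici 0 ∪ {w : ℂ | R ≤ w.re}, ?_, Or.inr ?_, Or.inl ?_,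
    h1.union (κ + R) ⟨R, hR0.le, rfl⟩ ?_ h2⟩
  · rintro _ (⟨t, ht, rfl⟩ | hw)
    · exact add_ofReal_mem_kappaDomain hβ₀ hr hκ ht
    · exact mem_kappaDomain_of_le_re hβ₀ hr hw
  · simp
  · exact ⟨0, Set.mem_Ici.2 le_rfl, by simp⟩
  · have := hκ.1
    simp only [Set.mem_ofPred_eq, Complex.add_re, Complex.ofReal_re]
    linarith

/-! ### The domain in the variable `z = κ²` -/

theorem sq_cpow_half {κ : ℂ} (hκ : 0 < κ.re) : (κ ^ 2) ^ (1 / 2 : ℂ) = κ := by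
  rw [one_div]
  exact Complex.sq_cpow_two_inv hκ

theorem cpow_half_sq (z : ℂ) : (z ^ (1 / 2 : ℂ)) ^ 2 = z := by
  rw [one_div]
  exact Complex.cpow_nat_inv_pow z two_ne_zero

theorem kappaSqDomain_eq_image (β₀ r : ℝ) :
    kappaSqDomain β₀ r = (fun κ => κ ^ 2) '' kappaDomain β₀ r := by
  ext z
  constructor
  · intro hz
    exact ⟨_, hz, cpow_half_sq z⟩
  · rintro ⟨κ, hκ, rfl⟩
    change (κ ^ 2) ^ (1 / 2 : ℂ) ∈ kappaDomain β₀ r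
    rwa [sq_cpow_half hκ.1]

theorem isConnected_kappaSqDomain {β₀ r : ℝ} (hβ₀ : 0 < β₀) (hr : 0 < r) :
    IsConnected (kappaSqDomain β₀ r) := by
  rw [kappaSqDomain_eq_image]
  exact (isConnected_kappaDomain hβ₀ hr).image _ (by fun_prop)

theorem isOpen_kappaSqDomain (β₀ : ℝ) {r : ℝ} (hr : 0 < r) : IsOpen (kappaSqDomain β₀ r) := by
  have hset : kappaSqDomain β₀ r =
      Complex.slitPlane ∩ (fun z : ℂ => z ^ (1 / 2 : ℂ)) ⁻¹' kappaDomain β₀ r := by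
    refine Set.Subset.antisymm (fun z hz => ⟨?_, hz⟩) fun z hz => hz.2
    rw [kappaSqDomain_eq_image] at hz
    obtain ⟨κ, hκ, rfl⟩ := hz
    have h0 := hκ.1
    simp only [Complex.mem_slitPlane_iff, sq, Complex.mul_re, Complex.mul_im]
    by_cases h : κ.im = 0
    · left
      rw [h]
      nlinarith
    · right
      have : κ.re * κ.im ≠ 0 := mul_ne_zero h0.ne' h
      intro h1
      exact this (by linarith)
  rw [hset]
  refine ContinuousOn.isOpen_inter_preimage (fun z hz => ?_) Complex.isOpen_slitPlane
    (isOpen_kappaDomain β₀ hr)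
  exact (continuousAt_cpow_const hz).continuousWithinAt

theorem accPt_kappaSqDomain {β₀ : ℝ} (r : ℝ) (hβ₀ : 0 < β₀) :
    AccPt (0 : ℂ) (𝓟 (kappaSqDomain β₀ r)) := by
  rw [accPt_iff_frequently]
  have h : Tendsto (fun n : ℕ => (((1 / ((n : ℝ) + 1) : ℝ) : ℂ)) ^ 2) atTop (𝓝 0) := by
    have h1 := (Complex.continuous_ofReal.tendsto 0).comp tendsto_one_div_add_atTop_nhds_zero_nat
    simpa [Function.comp_def] using h1.pow 2
  refine h.frequently (Frequently.of_forall fun n => ?_)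
  have hpos : 0 < 1 / ((n : ℝ) + 1) := by positivity
  refine ⟨pow_ne_zero 2 (Complex.ofReal_ne_zero.2 hpos.ne'), ?_⟩
  rw [kappaSqDomain_eq_image]
  exact ⟨_, ofReal_mem_kappaDomain hβ₀ hpos, rfl⟩

/-! ### Transseries in real powers -/

theorem norm_realPower (e : ℝ) (z : ℂ) : ‖realPower e z‖ = ‖z‖ ^ e :=
  Complex.norm_cpow_real z e

theorem realPower_add {z : ℂ} (hz : z ≠ 0) (a b : ℝ) :
    realPower (a + b) z = realPower a z * realPower b z := by
  rw [realPower, Complex.ofReal_add, Complex.cpow_add _ _ hz]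
  rfl

theorem realPower_natCast (n : ℕ) : realPower (n : ℝ) = fun z => z ^ n := by
  ext z
  rw [realPower, Complex.ofReal_natCast, Complex.cpow_natCast]

theorem isTransmonomialGroup_realPower (D : Set ℂ) :
    IsTransmonomialGroup realPower (fun n : ℤ => (n : ℝ)) D 0 where
  map_add a b z _ hz := realPower_add hz a b
  map_pow n z _ _ := by
    rw [realPower, Complex.ofReal_intCast, Complex.cpow_intCast, sub_zero]

theorem tendsto_realPower {e : ℝ} (he : 0 < e) : Tendsto (realPower e) (𝓝 0) (𝓝 0) := by
  rw [tendsto_zero_iff_norm_tendsto_zero]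
  simp only [norm_realPower]
  have h := (Real.continuousAt_rpow_const (0 : ℝ) e (Or.inr he.le)).tendsto
  rw [Real.zero_rpow he.ne'] at h
  exact h.comp tendsto_norm_zero

theorem realPower_isLittleO (s : Set ℂ) {a b : ℝ} (h : b < a) :
    realPower a =o[𝓝[s \ {0}] 0] realPower b := by
  have h1 : realPower (a - b) =o[𝓝[s \ {0}] 0] fun _ => (1 : ℂ) :=
    (isLittleO_one_iff ℂ).2 ((tendsto_realPower (sub_pos.2 h)).mono_left nhdsWithin_le_nhds)
  refine (h1.mul_isBigO (isBigO_refl (realPower b) _)).congr' ?_ (by simp)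
  filter_upwards [self_mem_nhdsWithin] with z hz
  rw [← realPower_add hz.2, sub_add_cancel]

theorem realPower_isBigO (s : Set ℂ) {a b : ℝ} (h : b ≤ a) :
    realPower a =O[𝓝[s \ {0}] 0] realPower b := by
  rcases h.eq_or_lt with rfl | h
  · exact isBigO_refl _ _
  · exact (realPower_isLittleO s h).isBigO

theorem nhdsWithin_diff_neBot {s : Set ℂ} (hs : AccPt 0 (𝓟 s)) : (𝓝[s \ {0}] (0 : ℂ)).NeBot := by
  rw [accPt_principal_iff_clusterPt] at hs
  exact hs

theorem not_realPower_isLittleO_self {s : Set ℂ} (hs : AccPt 0 (𝓟 s)) (e : ℝ) :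
    ¬ realPower e =o[𝓝[s \ {0}] 0] realPower e := by
  have := nhdsWithin_diff_neBot hs
  refine isLittleO_irrefl (Eventually.frequently ?_)
  filter_upwards [self_mem_nhdsWithin] with z hz
  rw [realPower, Complex.cpow_ne_zero_iff]
  exact Or.inl hz.2

theorem realPower_isLittleO_pow_iff {s : Set ℂ} (hs : AccPt 0 (𝓟 s)) (e : ℝ) (n : ℕ) :
    (realPower e =o[𝓝[s \ {0}] 0] fun z => (z - 0) ^ n) ↔ (n : ℝ) < e := by
  simp only [sub_zero]
  rw [← realPower_natCast]
  refine ⟨fun h => ?_, realPower_isLittleO s⟩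
  by_contra! hle
  exact not_realPower_isLittleO_self hs e (h.trans_isBigO (realPower_isBigO s hle))

/-- Otherwise the least exponent with a nonzero coefficient would dominate all other terms and the
error. -/
theorem coeff_eq_zero_of_isLittleO {s : Set ℂ} (hs : AccPt 0 (𝓟 s)) {G : Finset ℝ} {d : ℝ → ℂ}
    {x : ℝ} (hG : ∀ e ∈ G, e ≤ x)
    (ho : (fun z => ∑ e ∈ G, d e * realPower e z) =o[𝓝[s \ {0}] 0] realPower x) :
    ∀ e ∈ G, d e = 0 := by
  by_contra! hne
  have hne' : (G.filter fun e => d e ≠ 0).Nonempty := by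
    obtain ⟨e, he, hd⟩ := hne
    exact ⟨e, Finset.mem_filter.2 ⟨he, hd⟩⟩
  set e₀ := (G.filter fun e => d e ≠ 0).min' hne' with he₀
  have hmem := Finset.min'_mem _ hne'
  rw [← he₀] at hmem
  obtain ⟨hmemG, hd0⟩ := Finset.mem_filter.1 hmem
  have h1 : (fun z => ∑ e ∈ G.erase e₀, d e * realPower e z) =o[𝓝[s \ {0}] 0] realPower e₀ := by
    refine IsLittleO.fun_sum fun e he => ?_
    obtain ⟨hne, heG⟩ := Finset.mem_erase.1 he
    by_cases hde : d e = 0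
    · simp [hde]
    · have hle : e₀ ≤ e := Finset.min'_le _ _ (Finset.mem_filter.2 ⟨heG, hde⟩)
      exact (realPower_isLittleO s (lt_of_le_of_ne hle hne.symm)).const_mul_left _
  have h2 := (ho.trans_isBigO (realPower_isBigO s (hG e₀ hmemG))).sub h1
  have h3 : (fun z => d e₀ * realPower e₀ z) =o[𝓝[s \ {0}] 0] realPower e₀ := by
    refine h2.congr_left fun z => ?_
    rw [← Finset.add_sum_erase G _ hmemG]
    ring
  exact not_realPower_isLittleO_self hs e₀ ((isLittleO_const_mul_left_iff hd0).1 h3)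

theorem HasTransseries.unique {s : Set ℂ} (hs : AccPt 0 (𝓟 s)) {f : ℂ → ℂ} {c c' : ℝ → ℂ}
    (h : HasTransseries realPower s 0 f c) (h' : HasTransseries realPower s 0 f c') : c = c' := by
  funext e
  obtain ⟨n, hn⟩ := exists_nat_ge e
  obtain ⟨F, hF, hFo⟩ := h.expansion n
  obtain ⟨F', hF', hFo'⟩ := h'.expansion n
  simp only [realPower_isLittleO_pow_iff hs, not_lt] at hF hF'
  have hle : ∀ x ∈ F ∪ F', x ≤ n := fun x hx => by
    rcases Finset.mem_union.1 hx with hx | hx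
    · exact ((hF x).1 hx).2
    · exact ((hF' x).1 hx).2
  have hs1 : ∀ z, ∑ x ∈ F, c x * realPower x z = ∑ x ∈ F ∪ F', c x * realPower x z := fun z => by
    refine Finset.sum_subset Finset.subset_union_left fun x hx hxF => ?_
    have : c x = 0 := by
      by_contra hcx
      exact hxF ((hF x).2 ⟨hcx, hle x hx⟩)
    rw [this, zero_mul]
  have hs2 : ∀ z, ∑ x ∈ F', c' x * realPower x z = ∑ x ∈ F ∪ F', c' x * realPower x z :=
    fun z => by
    refine Finset.sum_subset Finset.subset_union_right fun x hx hxF => ?_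
    have : c' x = 0 := by
      by_contra hcx
      exact hxF ((hF' x).2 ⟨hcx, hle x hx⟩)
    rw [this, zero_mul]
  have ho : (fun z => ∑ x ∈ F ∪ F', (c x - c' x) * realPower x z) =o[𝓝[s \ {0}] 0]
      realPower (n : ℝ) := by
    rw [realPower_natCast]
    have h1 := hFo'.sub hFo
    simp only [sub_zero] at h1
    refine h1.congr_left fun z => ?_
    simp only [hs1, hs2, sub_mul, Finset.sum_sub_distrib]
    ring
  have hz := coeff_eq_zero_of_isLittleO hs hle ho
  by_cases heU : e ∈ F ∪ F'
  · exact sub_eq_zero.1 (hz e heU)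
  · rw [Finset.mem_union, not_or, hF, hF'] at heU
    have h1 : c e = 0 := by
      by_contra h0
      exact heU.1 ⟨h0, hn⟩
    have h2 : c' e = 0 := by
      by_contra h0
      exact heU.2 ⟨h0, hn⟩
    rw [h1, h2]

/-- The coefficient function with value `a k` at the exponent `k + 1/2` for `k ≥ 1`. -/
noncomputable def halfOddCoeff (a : ℕ → ℂ) (e : ℝ) : ℂ :=
  if e = ⌊e⌋₊ + 1 / 2 ∧ 1 ≤ ⌊e⌋₊ then a ⌊e⌋₊ else 0

theorem floor_add_half (k : ℕ) : ⌊(k : ℝ) + 1 / 2⌋₊ = k := by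
  rw [Nat.floor_eq_iff (by positivity)]
  constructor <;> linarith

theorem halfOddCoeff_add_half (a : ℕ → ℂ) {k : ℕ} (hk : 1 ≤ k) :
    halfOddCoeff a (k + 1 / 2) = a k := by
  rw [halfOddCoeff, floor_add_half, if_pos ⟨rfl, hk⟩]

theorem halfOddCoeff_natCast (a : ℕ → ℂ) (n : ℕ) : halfOddCoeff a n = 0 := by
  rw [halfOddCoeff, Nat.floor_natCast, if_neg]
  rintro ⟨h, -⟩
  linarith

theorem cpow_half_pow_odd {z : ℂ} (hz : z ≠ 0) (k : ℕ) :
    (z ^ (1 / 2 : ℂ)) ^ (2 * k + 1) = realPower (k + 1 / 2) z := by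
  rw [realPower_add hz, realPower_natCast, pow_succ, pow_mul, cpow_half_sq, realPower]
  norm_num

theorem tendsto_cpow_half {β₀ r : ℝ} {s : Set ℂ} (hs : s ⊆ kappaSqDomain β₀ r) :
    Tendsto (fun z : ℂ => z ^ (1 / 2 : ℂ)) (𝓝[s \ {0}] 0) (𝓝[kappaDomain β₀ r] 0) := by
  refine tendsto_nhdsWithin_iff.2 ⟨?_, ?_⟩
  · have h := (tendsto_realPower (e := 1 / 2) (by norm_num)).mono_left
      (nhdsWithin_le_nhds (s := s \ {0}))
    refine h.congr fun z => ?_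
    rw [realPower]
    norm_num
  · filter_upwards [self_mem_nhdsWithin] with z hz
    exact hs hz.1

theorem hasTransseries_halfOddCoeff {β₀ r : ℝ} {s : Set ℂ} (hs : s ⊆ kappaSqDomain β₀ r)
    (hacc : AccPt 0 (𝓟 s)) {g : ℂ → ℂ} {a : ℕ → ℂ}
    (hg : ∀ N : ℕ, (fun κ : ℂ => g κ - ∑ n ∈ Finset.Icc 1 N, a n * κ ^ (2 * n + 1))
      =O[𝓝[kappaDomain β₀ r] 0] fun κ => κ ^ (2 * N + 3)) :
    HasTransseries realPower s 0 (fun z => g (z ^ (1 / 2 : ℂ))) (halfOddCoeff a) where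
  comparable x y hxy := by
    rcases lt_or_gt_of_ne hxy with h | h
    · exact Or.inr (realPower_isLittleO s h)
    · exact Or.inl (realPower_isLittleO s h)
  expansion n := by
    have hinj : Function.Injective fun k : ℕ => (k : ℝ) + 1 / 2 := fun i j hij => by
      simpa using hij
    -- An exponent `k + 1/2` is at most `n` exactly when `k ≤ n - 1`. For `n = 0` the truncated
    -- range is empty and the remainder `O(κ³)` still suffices.
    refine ⟨((Finset.Icc 1 (n - 1)).filter fun k => a k ≠ 0).image fun k : ℕ => (k : ℝ) + 1 / 2,
      fun e => ?_, ?_⟩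
    · rw [realPower_isLittleO_pow_iff hacc, not_lt, Finset.mem_image]
      constructor
      · rintro ⟨k, hk, rfl⟩
        rw [Finset.mem_filter, Finset.mem_Icc] at hk
        refine ⟨by rw [halfOddCoeff_add_half a hk.1.1]; exact hk.2, ?_⟩
        have h1 : ((k + 1 : ℕ) : ℝ) ≤ n := Nat.cast_le.2 (by omega)
        push_cast at h1
        linarith
      · rintro ⟨hc, hle⟩
        rw [halfOddCoeff] at hc
        split_ifs at hc with h
        · refine ⟨⌊e⌋₊, ?_, h.1.symm⟩
          have h1 : (⌊e⌋₊ : ℝ) < n := by linarith [h.1]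
          have h2 : ⌊e⌋₊ < n := Nat.cast_lt.1 h1
          rw [Finset.mem_filter, Finset.mem_Icc]
          exact ⟨⟨h.2, by omega⟩, hc⟩
        · exact absurd rfl hc
    · have h1 := (hg (n - 1)).comp_tendsto (tendsto_cpow_half hs)
      have h2 : (fun z : ℂ => (z ^ (1 / 2 : ℂ)) ^ (2 * (n - 1) + 3)) =o[𝓝[s \ {0}] 0]
          fun z => (z - 0) ^ n := by
        have h3 : ((n : ℝ)) < ((n - 1 + 1 : ℕ) : ℝ) + 1 / 2 := by
          have : (n : ℝ) ≤ ((n - 1 + 1 : ℕ) : ℝ) := Nat.cast_le.2 (by omega)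
          linarith
        refine ((realPower_isLittleO_pow_iff hacc _ n).2 h3).congr' ?_ .rfl
        filter_upwards [self_mem_nhdsWithin] with z hz
        rw [← cpow_half_pow_odd hz.2]
        ring_nf
      refine (h1.trans_isLittleO h2).congr' ?_ .rfl
      filter_upwards [self_mem_nhdsWithin] with z hz
      simp only [Function.comp_apply]
      congr 1
      rw [Finset.sum_image hinj.injOn, Finset.sum_filter]
      refine Finset.sum_congr rfl fun k hk => ?_
      rw [cpow_half_pow_odd hz.2, halfOddCoeff_add_half a (Finset.mem_Icc.1 hk).1]
      split_ifs with h
      · rfl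
      · rw [not_not.1 h, zero_mul]

/-! ### Vanishing of the analytic distillate -/

theorem ofScalars_zero : FormalMultilinearSeries.ofScalars ℂ (0 : ℕ → ℂ) = 0 := by
  ext n
  simp [FormalMultilinearSeries.ofScalars]

theorem isAnalyticDistillate_zero {β₀ r : ℝ} (hβ₀ : 0 < β₀) (hr : 0 < r) {g : ℂ → ℂ} {a : ℕ → ℂ}
    (hg : ∀ N : ℕ, (fun κ : ℂ => g κ - ∑ n ∈ Finset.Icc 1 N, a n * κ ^ (2 * n + 1))
      =O[𝓝[kappaDomain β₀ r] 0] fun κ => κ ^ (2 * N + 3)) :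
    IsAnalyticDistillate realPower (fun n : ℤ => (n : ℝ)) (kappaSqDomain β₀ r) 0
      (fun z => g (z ^ (1 / 2 : ℂ))) (fun _ => 0) := by
  have hacc := accPt_kappaSqDomain r hβ₀
  refine ⟨isOpen_kappaSqDomain β₀ hr, isConnected_kappaSqDomain hβ₀ hr,
    mem_closure_iff_clusterPt.2 hacc.clusterPt, isTransmonomialGroup_realPower _,
    Unit, ⟨()⟩, fun _ => kappaSqDomain β₀ r, fun _ => halfOddCoeff a, 0, ?_, fun _ => ⟨hacc, ?_⟩,
    fun n => Or.inl fun _ => ?_, ?_⟩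
  · exact Set.iUnion_const _
  · exact hasTransseries_halfOddCoeff subset_rfl hacc hg
  · simpa using halfOddCoeff_natCast a n
  · rw [ofScalars_zero]
    have h := hasFPowerSeriesAt_const (𝕜 := ℂ) (E := ℂ) (c := (0 : ℂ)) (e := (0 : ℂ))
    rwa [constFormalMultilinearSeries_zero] at h

/-- Every member of a covering accumulates at `0`, so uniqueness forces the half-odd expansion on
each of them; its coefficients at integers are zero. -/
theorem IsAnalyticDistillate.eventuallyEq_zero {β₀ r : ℝ} {f : ℂ → ℂ}
    {g : ℂ → ℂ} {a : ℕ → ℂ}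
    (hg : ∀ N : ℕ, (fun κ : ℂ => g κ - ∑ n ∈ Finset.Icc 1 N, a n * κ ^ (2 * n + 1))
      =O[𝓝[kappaDomain β₀ r] 0] fun κ => κ ^ (2 * N + 3))
    (h : IsAnalyticDistillate realPower (fun n : ℤ => (n : ℝ)) (kappaSqDomain β₀ r) 0
      (fun z => g (z ^ (1 / 2 : ℂ))) f) : f =ᶠ[𝓝 0] fun _ => 0 := by
  obtain ⟨-, -, -, -, ι, ⟨i⟩, s, c, b, hU, hs, hb, hf⟩ := h
  have hsub : ∀ j, s j ⊆ kappaSqDomain β₀ r := fun j => by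
    rw [← hU]
    exact Set.subset_iUnion s j
  have hc : ∀ j, c j = halfOddCoeff a := fun j =>
    HasTransseries.unique (hs j).1 (hs j).2
      (hasTransseries_halfOddCoeff (hsub j) (hs j).1 hg)
  have hb0 : b = 0 := funext fun n => by
    rcases hb n with h | h
    · rw [← h i, hc]
      simpa using halfOddCoeff_natCast a n
    · exact h.1
  rw [hb0, ofScalars_zero] at hf
  exact hf.eventually_eq_zero

/-! ### Even power series with real coefficients -/

/-- Near `0` the function is the sum of a power series in `κ²` with real coefficients. -/
def EvenRealSeries (f : ℂ → ℂ) : Prop :=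
  ∃ a : ℕ → ℝ, ∀ᶠ κ in 𝓝[≠] (0 : ℂ), HasSum (fun n : ℕ => (a n : ℂ) * κ ^ (2 * n)) (f κ)

namespace EvenRealSeries

variable {f g : ℂ → ℂ}

theorem const (c : ℝ) : EvenRealSeries fun _ => c := by
  refine ⟨fun n => if n = 0 then c else 0, Eventually.of_forall fun κ => ?_⟩
  have h := hasSum_ite_eq (0 : ℕ) (c : ℂ)
  refine h.congr_fun fun n => ?_
  split_ifs with hn <;> simp [hn]

theorem sq : EvenRealSeries fun κ => κ ^ 2 := by
  refine ⟨fun n => if n = 1 then 1 else 0, Eventually.of_forall fun κ => ?_⟩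
  have h := hasSum_ite_eq (1 : ℕ) (κ ^ 2)
  refine h.congr_fun fun n => ?_
  split_ifs with hn <;> simp [hn]

theorem add (hf : EvenRealSeries f) (hg : EvenRealSeries g) :
    EvenRealSeries fun κ => f κ + g κ := by
  obtain ⟨a, ha⟩ := hf
  obtain ⟨b, hb⟩ := hg
  refine ⟨fun n => a n + b n, ?_⟩
  filter_upwards [ha, hb] with κ h1 h2
  refine (h1.add h2).congr_fun fun n => ?_
  push_cast
  ring

theorem mul (hf : EvenRealSeries f) (hg : EvenRealSeries g) :
    EvenRealSeries fun κ => f κ * g κ := by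
  obtain ⟨a, ha⟩ := hf
  obtain ⟨b, hb⟩ := hg
  refine ⟨fun n => ∑ p ∈ Finset.HasAntidiagonal.antidiagonal n, a p.1 * b p.2, ?_⟩
  filter_upwards [ha, hb] with κ h1 h2
  have h3 := tsum_mul_tsum_eq_tsum_sum_antidiagonal_of_summable_norm h1.summable.norm
    h2.summable.norm
  have h4 := (summable_norm_sum_mul_antidiagonal_of_summable_norm h1.summable.norm
    h2.summable.norm).of_norm.hasSum
  rw [← h3, h1.tsum_eq, h2.tsum_eq] at h4
  refine h4.congr_fun fun n => ?_
  push_cast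
  rw [Finset.sum_mul]
  refine Finset.sum_congr rfl fun p hp => ?_
  rw [← Finset.HasAntidiagonal.mem_antidiagonal.1 hp]
  ring

theorem const_mul (c : ℝ) (hf : EvenRealSeries f) : EvenRealSeries fun κ => c * f κ :=
  (const c).mul hf

theorem eventually_norm_lt (r : ℝ) : ∀ᶠ κ in 𝓝[≠] (0 : ℂ), ‖(r : ℂ) * κ‖ < 1 := by
  have h : Tendsto (fun κ : ℂ => ‖(r : ℂ) * κ‖) (𝓝[≠] 0) (𝓝 0) := by
    have : Continuous fun κ : ℂ => ‖(r : ℂ) * κ‖ := by fun_prop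
    simpa using (this.tendsto 0).mono_left nhdsWithin_le_nhds
  exact h.eventually_lt_const one_pos

theorem inv_one_add_sq (r : ℝ) : EvenRealSeries fun κ => (1 + (r : ℂ) ^ 2 * κ ^ 2)⁻¹ := by
  refine ⟨fun n => (-1) ^ n * r ^ (2 * n), ?_⟩
  filter_upwards [eventually_norm_lt r] with κ h
  have h1 : ‖-((r : ℂ) * κ) ^ 2‖ < 1 := by
    rw [norm_neg, norm_pow]
    exact pow_lt_one₀ (norm_nonneg _) h two_ne_zero
  have h2 := hasSum_geometric_of_norm_lt_one h1
  rw [sub_neg_eq_add, mul_pow] at h2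
  refine h2.congr_fun fun n => ?_
  push_cast
  rw [neg_pow ((r : ℂ) ^ 2 * κ ^ 2), mul_pow, pow_mul, pow_mul]
  ring

/-- With `q = r κ` this is `1/3 - q²/5 + …`. At `κ = 0` division by zero gives `0` rather than
`1/3`, hence the punctured neighbourhood in `EvenRealSeries`. -/
theorem arctan_remainder {r : ℝ} (hr : r ≠ 0) :
    EvenRealSeries fun κ => (1 - Complex.arctan (r * κ) / (r * κ)) / (r * κ) ^ 2 := by
  refine ⟨fun n => (-1) ^ n * r ^ (2 * n) / (2 * n + 3), ?_⟩
  filter_upwards [eventually_norm_lt r, self_mem_nhdsWithin] with κ h hκ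
  have hr' : (r : ℂ) ≠ 0 := Complex.ofReal_ne_zero.2 hr
  have hκ' : κ ≠ 0 := hκ
  have h1 := (hasSum_nat_add_iff' 1).2 (Complex.hasSum_arctan h)
  have h2 := h1.mul_left (-(1 / ((r : ℂ) * κ) ^ 3))
  convert! h2 using 1
  · ext n
    have h3 : (2 * (n : ℂ) + 3) ≠ 0 := by
      exact_mod_cast (show 2 * n + 3 ≠ 0 by omega)
    have h4 : (2 * ((n : ℂ) + 1) + 1) ≠ 0 := by
      exact_mod_cast (show 2 * (n + 1) + 1 ≠ 0 by omega)
    have h5 : ((r : ℂ) * κ) ^ (2 * (n + 1) + 1) = (r : ℂ) ^ (2 * n) * κ ^ (2 * n) *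
      ((r : ℂ) * κ) ^ 3 := by ring
    push_cast
    rw [h5]
    field_simp
    ring
  · simp
    field_simp
    ring

theorem exists_isBigO (hf : EvenRealSeries f) : ∃ a : ℕ → ℝ, ∀ N : ℕ,
    (fun κ => f κ - ∑ n ∈ Finset.range N, (a n : ℂ) * κ ^ (2 * n)) =O[𝓝[≠] 0]
      fun κ => κ ^ (2 * N) := by
  obtain ⟨a, ha⟩ := hf
  refine ⟨a, fun N => ?_⟩
  -- Convergence at one point `κ₀ ≠ 0` bounds the coefficients; for `‖κ‖ < ‖κ₀‖/2` the tail is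
  -- dominated by a geometric series of ratio `1/4`.
  obtain ⟨κ₀, h0, hκ₀⟩ := (ha.and self_mem_nhdsWithin).exists
  have hρ : 0 < ‖κ₀‖ := norm_pos_iff.2 hκ₀
  obtain ⟨C, hC⟩ := h0.summable.norm.tendsto_atTop_zero.bddAbove_range
  have hC' : ∀ n, ‖(a n : ℂ)‖ ≤ C * (‖κ₀‖ ^ (2 * n))⁻¹ := fun n => by
    have h1 : ‖(a n : ℂ) * κ₀ ^ (2 * n)‖ ≤ C := hC ⟨n, rfl⟩
    rw [norm_mul, norm_pow] at h1
    rwa [← div_eq_mul_inv, le_div_iff₀ (by positivity)]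
  have hC0 : 0 ≤ C := by simpa using (norm_nonneg _).trans (hC' 0)
  refine IsBigO.of_bound (C * (‖κ₀‖ ^ (2 * N))⁻¹ * (1 - 1 / 4)⁻¹) ?_
  have hsmall : ∀ᶠ κ in 𝓝[≠] (0 : ℂ), ‖κ‖ < ‖κ₀‖ / 2 :=
    (tendsto_norm_zero.mono_left nhdsWithin_le_nhds).eventually_lt_const (by positivity)
  filter_upwards [ha, hsmall] with κ h hκ
  have h1 := (hasSum_nat_add_iff' N).2 h
  have h2 := tsum_of_norm_bounded
    ((hasSum_geometric_of_lt_one (r := (1 / 4 : ℝ)) (by norm_num) (by norm_num)).mul_left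
      (C * (‖κ₀‖ ^ (2 * N))⁻¹ * ‖κ‖ ^ (2 * N)))
    (f := fun n : ℕ => (a (n + N) : ℂ) * κ ^ (2 * (n + N))) fun n => ?_
  · rw [h1.tsum_eq] at h2
    rw [norm_pow]
    linarith
  · have h3 : ‖κ‖ ^ (2 * n) * (‖κ₀‖ ^ (2 * n))⁻¹ ≤ (1 / 4) ^ n := by
      rw [← div_eq_mul_inv, ← div_pow, pow_mul]
      refine pow_le_pow_left₀ (by positivity) ?_ n
      have h4 : ‖κ‖ / ‖κ₀‖ ≤ 1 / 2 := by
        rw [div_le_iff₀ hρ]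
        linarith
      have h5 : 0 ≤ ‖κ‖ / ‖κ₀‖ := by positivity
      nlinarith
    rw [norm_mul, norm_pow]
    calc ‖(a (n + N) : ℂ)‖ * ‖κ‖ ^ (2 * (n + N))
        ≤ C * (‖κ₀‖ ^ (2 * (n + N)))⁻¹ * ‖κ‖ ^ (2 * (n + N)) := by
          gcongr
          exact hC' _
      _ = C * (‖κ₀‖ ^ (2 * N))⁻¹ * ‖κ‖ ^ (2 * N) * (‖κ‖ ^ (2 * n) * (‖κ₀‖ ^ (2 * n))⁻¹) := by
          rw [mul_add, pow_add, pow_add, mul_inv]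
          ring
      _ ≤ _ := by gcongr

end EvenRealSeries

/-! ### Geometry of the static observers -/

theorem one_add_sq_ne_zero {r : ℝ} (hr : 0 < r) {κ : ℂ} (hκ : 0 < κ.re) :
    1 + (r : ℂ) ^ 2 * κ ^ 2 ≠ 0 := by
  obtain ⟨h1, h2⟩ := one_add_mul_I_ne_zero (re_mul_ofReal_pos hκ hr)
  have h3 : 1 + (r : ℂ) ^ 2 * κ ^ 2 = (1 + κ * r * Complex.I) * (1 - κ * r * Complex.I) := by
    linear_combination (κ * r) ^ 2 * Complex.I_mul_I
  rw [h3]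
  exact mul_ne_zero h1 h2

theorem adsMetric_update_time (κ : ℂ) (x : Fin 4 → ℝ) (s : ℝ) :
    adsMetric κ (Function.update x 0 s) = adsMetric κ x := by
  simp [adsMetric]

theorem coordDeriv_time_eq_zero {F : (Fin 4 → ℝ) → ℂ} {x : Fin 4 → ℝ}
    (hF : ∀ s, F (Function.update x 0 s) = F x) : coordDeriv 0 F x = 0 := by
  simp [coordDeriv, hF]

theorem fourTempSq_eq (β₀ : ℝ) (κ : ℂ) (x : Fin 4 → ℝ) :
    fourTempSq β₀ κ x = (β₀ : ℂ) ^ 2 * (1 + (x 1 : ℂ) ^ 2 * κ ^ 2) := by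
  simp [fourTempSq, adsMetric, fourTemp, Fin.sum_univ_four]
  ring

theorem velocityUp_eq_zero (β₀ : ℝ) (κ : ℂ) (x : Fin 4 → ℝ) {μ : Fin 4} (hμ : μ ≠ 0) :
    velocityUp β₀ κ x μ = 0 := by
  fin_cases μ
  · exact absurd rfl hμ
  all_goals simp [velocityUp, fourTemp]

theorem velocity_eq (β₀ : ℝ) (κ : ℂ) (x : Fin 4 → ℝ) (μ : Fin 4) :
    velocity β₀ κ x μ =
      if μ = 0 then (1 + (x 1 : ℂ) ^ 2 * κ ^ 2) * velocityUp β₀ κ x 0 else 0 := by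
  rw [velocity, Finset.sum_eq_single 0]
  · fin_cases μ <;> simp [adsMetric]
  · intro ν _ hν
    rw [velocityUp_eq_zero β₀ κ x hν, mul_zero]
  · simp

/-- Both `A` and `u_μ u_ν` involve the square root only through this square, so its branch is
irrelevant. -/
theorem velocityUp_sq {β₀ : ℝ} (hβ₀ : 0 < β₀) {κ : ℂ} {x : Fin 4 → ℝ}
    (hw : 1 + (x 1 : ℂ) ^ 2 * κ ^ 2 ≠ 0) :
    velocityUp β₀ κ x 0 ^ 2 = (1 + (x 1 : ℂ) ^ 2 * κ ^ 2)⁻¹ := by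
  have hβ : (β₀ : ℂ) ≠ 0 := Complex.ofReal_ne_zero.2 hβ₀.ne'
  rw [velocityUp, div_pow, cpow_half_sq, fourTempSq_eq]
  simp only [fourTemp, Matrix.cons_val_zero]
  field_simp

theorem adsMetric_inv {κ : ℂ} {x : Fin 4 → ℝ} (hw : 1 + (x 1 : ℂ) ^ 2 * κ ^ 2 ≠ 0)
    (hx : x 1 ≠ 0) (hsin : Real.sin (x 2) ≠ 0) (b : Fin 4) :
    (adsMetric κ x)⁻¹ 0 b = if b = 0 then (1 + (x 1 : ℂ) ^ 2 * κ ^ 2)⁻¹ else 0 := by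
  have hx' : (x 1 : ℂ) ≠ 0 := Complex.ofReal_ne_zero.2 hx
  have hs' : (Real.sin (x 2) : ℂ) ≠ 0 := Complex.ofReal_ne_zero.2 hsin
  have h : (adsMetric κ x)⁻¹ = Matrix.diagonal ![(1 + (x 1 : ℂ) ^ 2 * κ ^ 2)⁻¹,
      -(1 + (x 1 : ℂ) ^ 2 * κ ^ 2), -((x 1 : ℂ) ^ 2)⁻¹,
      -((x 1 : ℂ) ^ 2 * (Real.sin (x 2) : ℂ) ^ 2)⁻¹] := by
    refine Matrix.inv_eq_right_inv ?_
    rw [adsMetric, Matrix.diagonal_mul_diagonal, ← Matrix.diagonal_one]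
    congr 1
    ext i
    fin_cases i
    · simp [hw]
    · have h1 : -(1 + (x 1 : ℂ) ^ 2 * κ ^ 2)⁻¹ * -(1 + (x 1 : ℂ) ^ 2 * κ ^ 2) = 1 := by
        rw [neg_mul_neg, inv_mul_cancel₀ hw]
      simpa using h1
    · simp [hx']
    · simpa using mul_inv_cancel₀ (mul_ne_zero (pow_ne_zero 2 hx') (pow_ne_zero 2 hs'))
  rw [h]
  fin_cases b <;> simp

theorem coordDeriv_adsMetric_time_time (κ : ℂ) (x : Fin 4 → ℝ) (μ : Fin 4) :
    coordDeriv μ (fun y => adsMetric κ y 0 0) x = if μ = 1 then 2 * (x 1 : ℂ) * κ ^ 2 else 0 := by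
  have h1 : HasDerivAt (fun s : ℝ => 1 + (s : ℂ) ^ 2 * κ ^ 2) (2 * (x 1 : ℂ) * κ ^ 2) (x 1) := by
    have h := (((Complex.ofRealCLM.hasDerivAt (x := x 1)).pow 2).mul_const (κ ^ 2)).const_add 1
    simpa using h
  by_cases h : μ = 1
  · subst h
    simpa [coordDeriv, adsMetric] using h1.deriv
  · rw [if_neg h]
    simp [coordDeriv, adsMetric, Function.update_of_ne (Ne.symm h)]

theorem christoffel_time_time {κ : ℂ} {x : Fin 4 → ℝ} (hw : 1 + (x 1 : ℂ) ^ 2 * κ ^ 2 ≠ 0)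
    (hx : x 1 ≠ 0) (hsin : Real.sin (x 2) ≠ 0) (μ : Fin 4) :
    christoffel (adsMetric κ) x 0 0 μ =
      if μ = 1 then (x 1 : ℂ) * κ ^ 2 * (1 + (x 1 : ℂ) ^ 2 * κ ^ 2)⁻¹ else 0 := by
  rw [christoffel, Finset.sum_eq_single 0]
  · rw [adsMetric_inv hw hx hsin, if_pos rfl, coordDeriv_adsMetric_time_time,
      coordDeriv_time_eq_zero fun s => by rw [adsMetric_update_time]]
    split_ifs
    · ring
    · ring
  · intro b _ hb
    rw [adsMetric_inv hw hx hsin, if_neg hb, zero_mul]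
  · simp

/-- Nothing depends on `t` and `u` points along `t`, so `A_μ = -Γ^t_{tμ} u^t u_t`. -/
theorem acceleration_eq {β₀ : ℝ} (hβ₀ : 0 < β₀) {κ : ℂ} {x : Fin 4 → ℝ}
    (hw : 1 + (x 1 : ℂ) ^ 2 * κ ^ 2 ≠ 0) (hx : x 1 ≠ 0) (hsin : Real.sin (x 2) ≠ 0) (μ : Fin 4) :
    acceleration β₀ κ x μ =
      if μ = 1 then -((x 1 : ℂ) * κ ^ 2 * (1 + (x 1 : ℂ) ^ 2 * κ ^ 2)⁻¹) else 0 := by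
  have hv : ∀ s, velocity β₀ κ (Function.update x 0 s) μ = velocity β₀ κ x μ := fun s => by
    simp only [velocity, velocityUp, fourTempSq, adsMetric_update_time]
  rw [acceleration, Finset.sum_eq_single 0]
  · rw [coordDeriv_time_eq_zero hv, Finset.sum_eq_single 0, christoffel_time_time hw hx hsin,
      velocity_eq, if_pos rfl]
    · have h := velocityUp_sq hβ₀ hw
      split_ifs
      · have h2 : velocityUp β₀ κ x 0 ^ 2 * (1 + (x 1 : ℂ) ^ 2 * κ ^ 2) = 1 := by
          rw [h, inv_mul_cancel₀ hw]
        linear_combination (-((x 1 : ℂ) * κ ^ 2 * (1 + (x 1 : ℂ) ^ 2 * κ ^ 2)⁻¹)) * h2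
      · ring
    · intro a _ ha
      rw [velocity_eq, if_neg ha, mul_zero]
    · simp
  · intro ν _ hν
    rw [velocityUp_eq_zero β₀ κ x hν, zero_mul]
  · simp

theorem velocity_mul_velocity {β₀ : ℝ} (hβ₀ : 0 < β₀) {κ : ℂ} {x : Fin 4 → ℝ}
    (hw : 1 + (x 1 : ℂ) ^ 2 * κ ^ 2 ≠ 0) (μ ν : Fin 4) :
    velocity β₀ κ x μ * velocity β₀ κ x ν =
      if μ = 0 ∧ ν = 0 then 1 + (x 1 : ℂ) ^ 2 * κ ^ 2 else 0 := by
  have h2 : velocityUp β₀ κ x 0 ^ 2 * (1 + (x 1 : ℂ) ^ 2 * κ ^ 2) = 1 := by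
    rw [velocityUp_sq hβ₀ hw, inv_mul_cancel₀ hw]
  rw [velocity_eq, velocity_eq]
  by_cases h : μ = 0 <;> by_cases h' : ν = 0 <;> simp only [h, h', if_true, if_false, and_true,
    and_false, and_self, mul_zero, zero_mul]
  linear_combination (1 + (x 1 : ℂ) ^ 2 * κ ^ 2) * h2

/-! ### The boundary term -/

theorem kappaDomain_ne_zero {β₀ r : ℝ} {κ : ℂ} (hκ : κ ∈ kappaDomain β₀ r) : κ ≠ 0 := by
  rintro rfl
  simpa using hκ.1

theorem kappaDomain_le_nhdsNE (β₀ r : ℝ) : 𝓝[kappaDomain β₀ r] (0 : ℂ) ≤ 𝓝[≠] 0 :=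
  nhdsWithin_mono _ fun _ hκ => kappaDomain_ne_zero hκ

theorem sum_Icc_odd_eq (b : ℕ → ℝ) (κ : ℂ) (N : ℕ) :
    ∑ n ∈ Finset.Icc 1 N, (b (n - 1) : ℂ) * κ ^ (2 * n + 1) =
      κ ^ 3 * ∑ n ∈ Finset.range N, (b n : ℂ) * κ ^ (2 * n) := by
  induction N with
  | zero => simp
  | succ N ih =>
    rw [Finset.sum_Icc_succ_top (by omega), Finset.sum_range_succ, ih, Nat.add_sub_cancel]
    ring

/-- Coefficients continuous at `0` preserve errors `O(κ^N)`, so the three series may be replaced by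
their expansions; `hmodel` then reduces each component to an algebraic identity. -/
theorem exists_odd_expansion {β₀ r : ℝ} (hβ₀ : 0 < β₀) (hr : 0 < r) {T c₀ c₁ c₂ Φ : ℂ → ℂ}
    (hc₀ : ContinuousAt c₀ 0) (hc₁ : ContinuousAt c₁ 0) (hc₂ : ContinuousAt c₂ 0)
    (hΦ : EvenRealSeries Φ)
    (hT : ∀ κ ∈ kappaDomain β₀ r,
      T κ = c₀ κ * seriesS β₀ r 0 κ + c₁ κ * seriesC β₀ r 1 κ + c₂ κ * seriesS β₀ r 2 κ)
    (hmodel : ∀ κ ∈ kappaDomain β₀ r,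
      c₀ κ * (-(Complex.arctan (r * κ) / (β₀ * κ)) + r * κ / 4)
        + c₁ κ * (-(1 / (2 * β₀ * κ)) + 1 / 8 + (r * κ) ^ 2 / 8)
        + c₂ κ * (-(r * κ / 8) - (r * κ) ^ 3 / 8) = κ ^ 3 * Φ κ) :
    ∃ a : ℕ → ℝ, ∀ N : ℕ,
      (fun κ : ℂ => T κ - ∑ n ∈ Finset.Icc 1 N, (a n : ℂ) * κ ^ (2 * n + 1))
        =O[𝓝[kappaDomain β₀ r] 0] fun κ => κ ^ (2 * N + 3) := by
  obtain ⟨b, hb⟩ := hΦ.exists_isBigO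
  refine ⟨fun n => b (n - 1), fun N => ?_⟩
  have hO : ∀ {c : ℂ → ℂ}, ContinuousAt c 0 → c =O[𝓝[kappaDomain β₀ r] 0] fun _ => (1 : ℂ) :=
    fun hc => (hc.tendsto.mono_left nhdsWithin_le_nhds).isBigO_one ℂ
  have h0 := (hO hc₀).mul (seriesS_zero_asymptotic hβ₀ hr (2 * N + 3))
  have h1 := (hO hc₁).mul (seriesC_one_asymptotic hβ₀ hr (2 * N + 3))
  have h2 := (hO hc₂).mul (seriesS_two_asymptotic hβ₀ hr (2 * N + 3))
  simp only [one_mul] at h0 h1 h2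
  have h3 := (isBigO_refl (fun κ : ℂ => κ ^ 3) (𝓝[kappaDomain β₀ r] 0)).mul
    ((hb N).mono (kappaDomain_le_nhdsNE β₀ r))
  have h4 : (fun κ : ℂ => κ ^ 3 * κ ^ (2 * N)) = fun κ => κ ^ (2 * N + 3) := by
    ext κ
    ring
  rw [h4] at h3
  refine (((h0.add h1).add h2).add h3).congr' ?_ .rfl
  filter_upwards [self_mem_nhdsWithin] with κ hκ
  rw [sum_Icc_odd_eq, hT κ hκ]
  linear_combination -(hmodel κ hκ)

theorem boundaryT_eq {β₀ r : ℝ} (hβ₀ : 0 < β₀) (hr : 0 < r) {x : Fin 4 → ℝ} (hx : x 1 = r)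
    (hsin : Real.sin (x 2) ≠ 0) {κ : ℂ} (hκ : 0 < κ.re) (μ ν : Fin 4) :
    boundaryT β₀ κ x μ ν = κ ^ 3 / (8 * (Real.pi : ℂ) ^ 2 * r) *
    ((1 / 6 * ((1 - κ ^ 2 * r ^ 2) / (κ ^ 2 * r ^ 2)) * seriesS β₀ r 0 κ
        - 1 / (3 * κ * r) * seriesC β₀ r 1 κ
        - 2 / 3 * (1 / (1 + r ^ 2 * κ ^ 2)) * seriesS β₀ r 2 κ) * adsMetric κ x μ ν
      + (1 / 6 * (3 - 1 / (κ ^ 2 * r ^ 2)) * seriesS β₀ r 0 κ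
        + 1 / (κ * r) * (1 - 2 / 3 * (1 / (1 + r ^ 2 * κ ^ 2))) * seriesC β₀ r 1 κ
        + 2 / (1 + r ^ 2 * κ ^ 2) * seriesS β₀ r 2 κ)
        * (if μ = 0 ∧ ν = 0 then 1 + (r : ℂ) ^ 2 * κ ^ 2 else 0)
      + (1 / 6 * (3 * ((1 + r ^ 2 * κ ^ 2) / (κ ^ 2 * r ^ 2)) - 4) * seriesS β₀ r 0 κ
        + 1 / (κ * r) * (2 / 3 * (κ ^ 2 * r ^ 2 / (1 + r ^ 2 * κ ^ 2)) - 1) * seriesC β₀ r 1 κ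
        - 2 / 3 * (1 / (1 + r ^ 2 * κ ^ 2)) * seriesS β₀ r 2 κ)
        * (if μ = 1 ∧ ν = 1 then (1 + (r : ℂ) ^ 2 * κ ^ 2)⁻¹ else 0)) := by
  have hw := one_add_sq_ne_zero hr hκ
  have hr' : (r : ℂ) ≠ 0 := Complex.ofReal_ne_zero.2 hr.ne'
  have hκ' : κ ≠ 0 := fun h => by simp [h] at hκ
  have hA : (1 + (r : ℂ) ^ 2 * κ ^ 2) / (r ^ 2 * κ ^ 4) *
      (acceleration β₀ κ x μ * acceleration β₀ κ x ν) =
      if μ = 1 ∧ ν = 1 then (1 + (r : ℂ) ^ 2 * κ ^ 2)⁻¹ else 0 := by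
    have hw' : 1 + (x 1 : ℂ) ^ 2 * κ ^ 2 ≠ 0 := by rwa [hx]
    rw [acceleration_eq hβ₀ hw' (hx ▸ hr.ne') hsin, acceleration_eq hβ₀ hw' (hx ▸ hr.ne') hsin, hx]
    by_cases h : μ = 1 <;> by_cases h' : ν = 1 <;> simp only [h, h', if_true, if_false, and_true,
      and_false, and_self, mul_zero, zero_mul]
    field_simp
  rw [← hA, ← hx, ← velocity_mul_velocity hβ₀ (by rwa [hx])]
  simp only [boundaryT]
  rw [mul_comm ((x 1 : ℂ) ^ 2) (κ ^ 2), mul_assoc (_ - 2 / 3 * (1 / _) * seriesS β₀ (x 1) 2 κ)]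

/-- The function `E` with `arctan q = q (1 - q² E)`, where `q = r κ`. -/
noncomputable def arctanRemainder (r : ℝ) (κ : ℂ) : ℂ :=
  (1 - Complex.arctan (r * κ) / (r * κ)) / (r * κ) ^ 2

theorem arctan_eq {r : ℝ} (hr : 0 < r) {κ : ℂ} (hκ : κ ≠ 0) :
    Complex.arctan (r * κ) = r * κ * (1 - (r * κ) ^ 2 * arctanRemainder r κ) := by
  have hr' : (r : ℂ) ≠ 0 := Complex.ofReal_ne_zero.2 hr.ne'
  rw [arctanRemainder]
  field_simp
  ring

theorem exists_adsMetric_eq (x : Fin 4 → ℝ) {μ ν : Fin 4} (h0 : ¬(μ = 0 ∧ ν = 0))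
    (h1 : ¬(μ = 1 ∧ ν = 1)) : ∃ s : ℝ, ∀ κ, adsMetric κ x μ ν = s := by
  by_cases h : μ = ν
  · subst h
    simp only [and_self] at h0 h1
    fin_cases μ
    · exact absurd rfl h0
    · exact absurd rfl h1
    · exact ⟨-x 1 ^ 2, fun κ => by simp [adsMetric]⟩
    · exact ⟨-(x 1 ^ 2 * Real.sin (x 2) ^ 2), fun κ => by simp [adsMetric]⟩
  · exact ⟨0, fun κ => by simp [adsMetric, Matrix.diagonal_apply_ne _ h]⟩

theorem boundaryT_expansion {β₀ r : ℝ} (hβ₀ : 0 < β₀) (hr : 0 < r) {x : Fin 4 → ℝ} (hx : x 1 = r)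
    (hsin : Real.sin (x 2) ≠ 0) (μ ν : Fin 4) :
    ∃ a : ℕ → ℝ, ∀ N : ℕ,
      (fun κ : ℂ => boundaryT β₀ κ x μ ν - ∑ n ∈ Finset.Icc 1 N, (a n : ℂ) * κ ^ (2 * n + 1))
        =O[𝓝[kappaDomain β₀ r] 0] fun κ => κ ^ (2 * N + 3) := by
  have hr' : (r : ℂ) ≠ 0 := Complex.ofReal_ne_zero.2 hr.ne'
  have hβ' : (β₀ : ℂ) ≠ 0 := Complex.ofReal_ne_zero.2 hβ₀.ne'
  have hπ : (Real.pi : ℂ) ≠ 0 := Complex.ofReal_ne_zero.2 Real.pi_ne_zero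
  have hcw : ContinuousAt (fun κ : ℂ => (1 + (r : ℂ) ^ 2 * κ ^ 2)⁻¹) 0 :=
    ContinuousAt.inv₀ (by fun_prop) (by simp)
  have hE : EvenRealSeries (arctanRemainder r) := EvenRealSeries.arctan_remainder hr.ne'
  have hG := EvenRealSeries.inv_one_add_sq r
  have hone := EvenRealSeries.const 1
  have hsq := EvenRealSeries.sq
  -- In each case `c₀`, `c₁`, `c₂` are the coefficients of the three series in that component, and
  -- `Φ` is what the `1/β₀` terms leave after the other terms cancel.
  by_cases h00 : μ = 0 ∧ ν = 0
  · refine exists_odd_expansion hβ₀ hr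
      (c₀ := fun κ => κ ^ 3 * (1 + r ^ 2 * κ ^ 2) / (24 * (Real.pi : ℂ) ^ 2 * r))
      (c₁ := fun κ => κ ^ 4 / (12 * (Real.pi : ℂ) ^ 2))
      (c₂ := fun κ => κ ^ 3 / (6 * (Real.pi : ℂ) ^ 2 * r))
      (Φ := fun κ => ((-(1 / (24 * Real.pi ^ 2 * β₀)) : ℝ) : ℂ) *
        ((1 : ℝ) + ((1 : ℝ) + ((r ^ 2 : ℝ) : ℂ) * κ ^ 2) *
          ((1 : ℝ) + ((-r ^ 2 : ℝ) : ℂ) * (κ ^ 2 * arctanRemainder r κ))))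
      (by fun_prop) (by fun_prop) (by fun_prop)
      ((hone.add ((hone.add (hsq.const_mul _)).mul
        (hone.add ((hsq.mul hE).const_mul _)))).const_mul _) ?_ ?_
    · intro κ hκ
      have hκ' : κ ≠ 0 := kappaDomain_ne_zero hκ
      have hw := one_add_sq_ne_zero hr hκ.1
      have hw' : 1 + κ ^ 2 * (r : ℂ) ^ 2 ≠ 0 := by rwa [mul_comm]
      have hg : adsMetric κ x 0 0 = 1 + (r : ℂ) ^ 2 * κ ^ 2 := by simp [adsMetric, hx]
      rw [boundaryT_eq hβ₀ hr hx hsin hκ.1, if_pos h00, h00.1, h00.2, hg,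
        if_neg (by decide), mul_zero, add_zero]
      field_simp
      ring
    · intro κ hκ
      have hκ' : κ ≠ 0 := kappaDomain_ne_zero hκ
      rw [arctan_eq hr hκ']
      push_cast
      field_simp
      ring
  -- Here the `1/β₀` terms start at order `κ`; that order cancels between `S_0` and `C_1`, leaving
  -- `κ³`.
  by_cases h11 : μ = 1 ∧ ν = 1
  · refine exists_odd_expansion hβ₀ hr
      (c₀ := fun κ => κ / (24 * (Real.pi : ℂ) ^ 2 * r ^ 3) * (1 + (r : ℂ) ^ 2 * κ ^ 2)⁻¹)
      (c₁ := fun κ => -(κ ^ 2 / (12 * (Real.pi : ℂ) ^ 2 * r ^ 2)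
        * ((1 + (r : ℂ) ^ 2 * κ ^ 2)⁻¹ * (1 + (r : ℂ) ^ 2 * κ ^ 2)⁻¹)))
      (c₂ := fun κ => 0)
      (Φ := fun κ => ((1 / (24 * Real.pi ^ 2 * β₀) : ℝ) : ℂ) *
        ((1 + (r : ℂ) ^ 2 * κ ^ 2)⁻¹ * (arctanRemainder r κ +
          ((-1 : ℝ) : ℂ) * (1 + (r : ℂ) ^ 2 * κ ^ 2)⁻¹)))
      (by fun_prop) (by fun_prop) (by fun_prop)
      ((hG.mul (hE.add (hG.const_mul _))).const_mul _) ?_ ?_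
    · intro κ hκ
      have hκ' : κ ≠ 0 := kappaDomain_ne_zero hκ
      have hw := one_add_sq_ne_zero hr hκ.1
      have hw' : 1 + κ ^ 2 * (r : ℂ) ^ 2 ≠ 0 := by rwa [mul_comm]
      have hg : adsMetric κ x 1 1 = -(1 + (r : ℂ) ^ 2 * κ ^ 2)⁻¹ := by simp [adsMetric, hx]
      rw [boundaryT_eq hβ₀ hr hx hsin hκ.1, if_pos h11, h11.1, h11.2, hg,
        if_neg (by decide), mul_zero, add_zero]
      field_simp
      ring
    · intro κ hκ
      have hκ' : κ ≠ 0 := kappaDomain_ne_zero hκ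
      have hw := one_add_sq_ne_zero hr hκ.1
      have hw' : 1 + κ ^ 2 * (r : ℂ) ^ 2 ≠ 0 := by rwa [mul_comm]
      rw [arctan_eq hr hκ']
      push_cast
      field_simp
      ring
  -- Only the metric term remains, and its component `s` is real and independent of `κ`.
  · obtain ⟨s, hs⟩ := exists_adsMetric_eq x h00 h11
    refine exists_odd_expansion hβ₀ hr
      (c₀ := fun κ => s * (κ * (1 - κ ^ 2 * r ^ 2) / (48 * (Real.pi : ℂ) ^ 2 * r ^ 3)))
      (c₁ := fun κ => -(s * (κ ^ 2 / (24 * (Real.pi : ℂ) ^ 2 * r ^ 2))))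
      (c₂ := fun κ => -(s * (κ ^ 3 / (12 * (Real.pi : ℂ) ^ 2 * r) * (1 + (r : ℂ) ^ 2 * κ ^ 2)⁻¹)))
      (Φ := fun κ => ((s / (48 * Real.pi ^ 2 * β₀) : ℝ) : ℂ) *
        ((1 : ℝ) + ((1 : ℝ) + ((-r ^ 2 : ℝ) : ℂ) * κ ^ 2) * arctanRemainder r κ))
      (by fun_prop) (by fun_prop) (by fun_prop)
      ((hone.add ((hone.add (hsq.const_mul _)).mul hE)).const_mul _) ?_ ?_
    · intro κ hκ
      have hκ' : κ ≠ 0 := kappaDomain_ne_zero hκ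
      have hw := one_add_sq_ne_zero hr hκ.1
      have hw' : 1 + κ ^ 2 * (r : ℂ) ^ 2 ≠ 0 := by rwa [mul_comm]
      rw [boundaryT_eq hβ₀ hr hx hsin hκ.1, hs, if_neg h00, if_neg h11, mul_zero, mul_zero,
        add_zero, add_zero]
      field_simp
      ring
    · intro κ hκ
      have hκ' : κ ≠ 0 := kappaDomain_ne_zero hκ
      have hw := one_add_sq_ne_zero hr hκ.1
      have hw' : 1 + κ ^ 2 * (r : ℂ) ^ 2 ≠ 0 := by rwa [mul_comm]
      rw [arctan_eq hr hκ']
      push_cast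
      field_simp
      ring

theorem mainTheorem2 (β₀ r : ℝ) (hβ₀ : 0 < β₀) (hr : 0 < r) :
    -- domain: where the series converge; it contains all `κ > 0`
    (∀ κ : ℝ, 0 < κ → (κ : ℂ) ∈ kappaDomain β₀ r) ∧
    (∀ (m : ℕ) (κ : ℂ), 0 < κ.re →
      ((Summable fun n : ℕ => sinTerm β₀ r m κ (n + 1)) ↔ κ ∈ kappaDomain β₀ r) ∧
      ((Summable fun n : ℕ => cosTerm β₀ r m κ (n + 1)) ↔ κ ∈ kappaDomain β₀ r)) ∧
    -- expansions of the three series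
    AsymptoticEq (kappaDomain β₀ r) (seriesS β₀ r 0)
      (fun κ => -(Complex.arctan (r * κ) / (β₀ * κ)) + r * κ / 4) ∧
    AsymptoticEq (kappaDomain β₀ r) (seriesC β₀ r 1)
      (fun κ => -(1 / (2 * β₀ * κ)) + 1 / 8 + (r * κ) ^ 2 / 8) ∧
    AsymptoticEq (kappaDomain β₀ r) (seriesS β₀ r 2)
      (fun κ => -(r * κ / 8) - (r * κ) ^ 3 / 8) ∧
    -- the boundary term
    ∀ x : Fin 4 → ℝ, x 1 = r → 0 < x 2 → x 2 < Real.pi → ∀ μ ν : Fin 4,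
      (∃ a : ℕ → ℝ, ∀ N : ℕ,
        (fun κ : ℂ => boundaryT β₀ κ x μ ν
            - ∑ n ∈ Finset.Icc 1 N, (a n : ℂ) * κ ^ (2 * n + 1))
          =O[𝓝[kappaDomain β₀ r] 0] fun κ => κ ^ (2 * N + 3)) ∧
      IsAnalyticDistillate realPower (fun n : ℤ => (n : ℝ)) (kappaSqDomain β₀ r) 0
        (fun z => boundaryT β₀ (z ^ (1 / 2 : ℂ)) x μ ν) (fun _ => 0) ∧
      ∀ g : ℂ → ℂ,
        IsAnalyticDistillate realPower (fun n : ℤ => (n : ℝ)) (kappaSqDomain β₀ r) 0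
          (fun z => boundaryT β₀ (z ^ (1 / 2 : ℂ)) x μ ν) g →
        g =ᶠ[𝓝 0] fun _ => 0 := by
  refine ⟨fun κ hκ => ofReal_mem_kappaDomain hβ₀ hκ,
    fun m κ hκ => summable_iff_mem_kappaDomain hβ₀ hκ m, seriesS_zero_asymptotic hβ₀ hr,
    seriesC_one_asymptotic hβ₀ hr, seriesS_two_asymptotic hβ₀ hr, fun x hx h0 hπ μ ν => ?_⟩
  obtain ⟨a, ha⟩ := boundaryT_expansion hβ₀ hr hx (Real.sin_pos_of_pos_of_lt_pi h0 hπ).ne' μ ν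
  exact ⟨⟨a, ha⟩,
    isAnalyticDistillate_zero (g := fun κ => boundaryT β₀ κ x μ ν) (a := fun n => (a n : ℂ))
      hβ₀ hr ha,
    fun g hg => IsAnalyticDistillate.eventuallyEq_zero (g := fun κ => boundaryT β₀ κ x μ ν)
      (a := fun n => (a n : ℂ)) ha hg⟩
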